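/- Let $\mathcal F$ be a field of characteristic $0$ with pairwise commuting derivations $\Delta=\{\partial_1,\dots,\partial_m\}$, let $D=\mathcal F[\partial_1,\dots,\partial_m]$ be the ring of linear differential operators over $\mathcal F$, and let $n\ge 1$. For $\theta=\partial_1^{i_1}\cdots\partial_m^{i_m}$ put $\operatorname{ord}\theta=i_1+\dots+i_m$; the order of an operator is the largest order of a $\theta$ that occurs in it with non-zero coefficient. Let $\Sigma\subset\mathcal F\{y_1,\dots,y_n\}$ be a (possibly infinite) system of linear differential polynomials (polynomials of degree $1$ in the derivatives $\theta y_j$), and let $e_1,\dots,e_n\ge 0$ be integers with $\operatorname{ord}_{y_j}f\le e_j$ for all $f\in\Sigma$ and $1\le j\le n$, where $\operatorname{ord}_{y_j}f$ is the largest order of a $\theta$ such that $\theta y_j$ occurs in $f$. Let $M$ be the free left $D$-module with basis $m_1,\dots,m_n$, and let $N\subseteq M$ be the submodule generated by the differentials $\sum_{j,\theta}a_{j,\theta}\,\theta m_j$ of the elements $\sum_{j,\theta}a_{j,\theta}\,\theta y_j+b$ of $\Sigma$. Let $(M/N)_r$ be the image in $M/N$ of the set of all $\sum_j\sigma_jm_j$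 with $\operatorname{ord}\sigma_j\le r$ for all $j$. For all large $s$ one has $\dim_{\mathcal F}(M/N)_s=\omega_{[\Sigma]}(s)=\sum_{i=0}^m a_i\binom{s+i}{i}$ with integers $a_i$ (the Kolchin dimension polynomial of $\Sigma$). Assume that $a_m=0$. Then there are a differential field extension $\mathcal G$ of $\mathcal F$ and elements $c_2,\dots,c_n\in\mathcal G$ such that, over the ring $\tilde D=\mathcal G\otimes_{\mathcal F}D$ of linear differential operators over $\mathcal G$, the module of differentials $\mathcal G\otimes_{\mathcal F}(M/N)$ of $\Sigma$ is generated by the single element $\psi=m_1+c_2m_2+\dots+c_nm_n$. Moreover there are $\lambda_1,\dots,\lambda_n\in\tilde D$ with $\lambda_j\psi=m_j$ and $$\operatorname{ord}\lambda_j\le 2^m(e_1+\dots+e_n)\qquad(1\le j\le n).$$ -/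

import Mathlib

universe u

noncomputable section

/-- A `Δ`-ring: a commutative ring with `m` pairwise commuting derivations `∂_1, …, ∂_m`. -/
class DeltaRing (m : ℕ) (K : Type*) [CommRing K] where
  der : Fin m → Derivation ℤ K K
  der_comm : ∀ (i j : Fin m) (a : K), der i (der j a) = der j (der i a)

/-- The ring `D = K[∂_1, …, ∂_m]` of linear differential operators over the `Δ`-ring `K`.  The
element `f` is the operator `∑ θ, f θ · ∂^θ`, where `∂^θ = ∂_1^{θ_1} ⋯ ∂_m^{θ_m}`. -/
def DiffOp (m : ℕ) (K : Type*) [CommRing K] : Type _ := (Fin m →₀ ℕ) →₀ K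

namespace DiffOp

variable {m : ℕ} {K : Type*} [CommRing K]

instance : AddCommGroup (DiffOp m K) := inferInstanceAs (AddCommGroup ((Fin m →₀ ℕ) →₀ K))

instance : Module K (DiffOp m K) := inferInstanceAs (Module K ((Fin m →₀ ℕ) →₀ K))

/-- The coefficient of `∂^θ` in an operator. -/
def coeff (f : DiffOp m K) (θ : Fin m →₀ ℕ) : K := Finsupp.toFun f θ

/-- The finite set of the `θ` such that `∂^θ` has a non-zero coefficient. -/
def support (f : DiffOp m K) : Finset (Fin m →₀ ℕ) := Finsupp.support f

/-- The operator `a ∂^θ`. -/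
def monomial (θ : Fin m →₀ ℕ) (a : K) : DiffOp m K := Finsupp.single θ a

instance : One (DiffOp m K) := ⟨monomial 0 1⟩

theorem add_hom_ext {A : Type*} [AddCommMonoid A] {f g : DiffOp m K →+ A}
    (h : ∀ θ a, f (monomial θ a) = g (monomial θ a)) : f = g :=
  Finsupp.addHom_ext h

theorem smul_monomial (a b : K) (θ : Fin m →₀ ℕ) :
    a • monomial θ b = monomial θ (a * b) :=
  Finsupp.smul_single a θ b

theorem monomial_add (a b : K) (θ : Fin m →₀ ℕ) :
    monomial θ (a + b) = monomial θ a + monomial θ b :=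
  Finsupp.single_add θ a b

variable [DeltaRing m K]

/-- Left multiplication by `∂_i`, as an additive map: `∂_i (a ∂^θ) = ∂_i(a) ∂^θ + a ∂_i ∂^θ`. -/
def derMul (i : Fin m) : AddMonoid.End (DiffOp m K) :=
  Finsupp.mapRange.addMonoidHom (DeltaRing.der (K := K) i : Derivation ℤ K K).toLinearMap.toAddMonoidHom
    + Finsupp.mapDomain.addMonoidHom (fun θ : Fin m →₀ ℕ => Finsupp.single i 1 + θ)

theorem derMul_monomial (i : Fin m) (θ : Fin m →₀ ℕ) (a : K) :
    derMul i (monomial θ a)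
      = monomial θ (DeltaRing.der i a) + monomial (Finsupp.single i 1 + θ) a := by
  have h1 := Finsupp.mapRange_single (a := θ) (b := a)
    (hf := map_zero (DeltaRing.der (K := K) i : Derivation ℤ K K).toLinearMap.toAddMonoidHom)
  have h2 := Finsupp.mapDomain_single (f := fun θ : Fin m →₀ ℕ => Finsupp.single i 1 + θ)
    (a := θ) (b := a)
  exact congrArg₂ (· + ·) h1 h2

theorem derMul_commute (i j : Fin m) :
    Commute (derMul i : AddMonoid.End (DiffOp m K)) (derMul j) := by
  refine add_hom_ext fun θ a => ?_
  change derMul i (derMul j (monomial θ a)) = derMul j (derMul i (monomial θ a))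
  simp only [derMul_monomial, map_add]
  rw [DeltaRing.der_comm i j, add_left_comm (Finsupp.single i 1) (Finsupp.single j 1) θ]
  abel

theorem derMul_smul (i : Fin m) (a : K) (f : DiffOp m K) :
    derMul i (a • f) = (DeltaRing.der i a : K) • f + a • derMul i f := by
  let l : DiffOp m K →+ DiffOp m K := (derMul i).comp (DistribSMul.toAddMonoidHom _ a)
  let r : DiffOp m K →+ DiffOp m K :=
    DistribSMul.toAddMonoidHom _ (DeltaRing.der i a : K)
      + (DistribSMul.toAddMonoidHom _ a).comp (derMul i)
  have h : l = r := by
    refine add_hom_ext fun θ b => ?_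
    change derMul i (a • monomial θ b)
      = (DeltaRing.der i a : K) • monomial θ b + a • derMul i (monomial θ b)
    simp only [smul_monomial, derMul_monomial, smul_add, Derivation.leibniz, smul_eq_mul,
      monomial_add]
    rw [mul_comm b]
    abel
  exact DFunLike.congr_fun h f

theorem powMul_comm (θ : Fin m →₀ ℕ) :
    ((Finset.univ : Finset (Fin m)) : Set (Fin m)).Pairwise
      (Function.onFun Commute fun i => (derMul i : AddMonoid.End (DiffOp m K)) ^ θ i) :=
  fun i _ j _ _ => (derMul_commute i j).pow_pow _ _

/-- Left multiplication by `∂^θ = ∂_1^{θ_1} ⋯ ∂_m^{θ_m}`. -/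
def powMul (θ : Fin m →₀ ℕ) : AddMonoid.End (DiffOp m K) :=
  Finset.univ.noncommProd (fun i => derMul i ^ θ i)
    (powMul_comm θ)

theorem powMul_zero : (powMul 0 : AddMonoid.End (DiffOp m K)) = 1 := by
  unfold powMul
  rw [Finset.noncommProd_eq_pow_card _ _ _ 1]
  · simp
  · intro i _
    simp

theorem powMul_add (θ η : Fin m →₀ ℕ) :
    (powMul (θ + η) : AddMonoid.End (DiffOp m K)) = powMul θ * powMul η := by
  unfold powMul
  rw [← Finset.noncommProd_mul_distrib]
  · refine Finset.noncommProd_congr rfl (fun i _ => ?_) _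
    simp [pow_add]
  · intro i _ j _ _
    exact (derMul_commute i j).pow_pow _ _

theorem powMul_single (i : Fin m) :
    (powMul (Finsupp.single i 1) : AddMonoid.End (DiffOp m K)) = derMul i := by
  unfold powMul
  have h1 := Finset.mul_noncommProd_erase Finset.univ (Finset.mem_univ i)
    (fun j => (derMul j : AddMonoid.End (DiffOp m K)) ^ (Finsupp.single i 1 : Fin m →₀ ℕ) j)
    (powMul_comm _)
  refine h1.symm.trans ((congrArg₂ (· * ·) ?_ ((Finset.noncommProd_eq_pow_card _ _ _ 1 ?_).trans
    (one_pow _))).trans (mul_one (derMul i)))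
  · simp
  · intro j hj
    simp [Finsupp.single_eq_of_ne (Finset.ne_of_mem_erase hj)]

/-- The additive map `f ↦ (g ↦ f * g)`, with `(∑ a_θ ∂^θ) * g = ∑ a_θ · ∂^θ g`. -/
def mulHom : DiffOp m K →+ AddMonoid.End (DiffOp m K) :=
  Finsupp.liftAddHom fun θ =>
    { toFun := fun a => (DistribSMul.toAddMonoidHom (DiffOp m K) a).comp (powMul θ)
      map_zero' := by
        ext1 g
        exact zero_smul K _
      map_add' := fun a b => by
        ext1 g
        exact add_smul a b _ }

theorem mulHom_monomial (θ : Fin m →₀ ℕ) (a : K) (g : DiffOp m K) :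
    mulHom (monomial θ a) g = a • powMul θ g := by
  exact DFunLike.congr_fun (Finsupp.liftAddHom_apply_single _ θ a) g

instance : Mul (DiffOp m K) := ⟨fun f g => mulHom f g⟩

theorem mul_def (f g : DiffOp m K) : f * g = mulHom f g := rfl

theorem monomial_mul (θ : Fin m →₀ ℕ) (a : K) (g : DiffOp m K) :
    monomial θ a * g = a • powMul θ g := mulHom_monomial θ a g

theorem smul_mul (a : K) (f g : DiffOp m K) : (a • f) * g = a • (f * g) := by
  let l : DiffOp m K →+ DiffOp m K :=
    (mulHom.flip g).comp (DistribSMul.toAddMonoidHom _ a)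
  let r : DiffOp m K →+ DiffOp m K :=
    (DistribSMul.toAddMonoidHom _ a).comp (mulHom.flip g)
  have h : l = r := by
    refine add_hom_ext fun θ b => ?_
    change (a • monomial θ b) * g = a • (monomial θ b * g)
    rw [smul_monomial, monomial_mul, monomial_mul, mul_smul]
  exact DFunLike.congr_fun h f

theorem derMul_mul (i : Fin m) (f g : DiffOp m K) :
    derMul i f * g = derMul i (f * g) := by
  let l : DiffOp m K →+ DiffOp m K := (mulHom.flip g).comp (derMul i)
  let r : DiffOp m K →+ DiffOp m K := (derMul i).comp (mulHom.flip g)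
  have h : l = r := by
    refine add_hom_ext fun θ b => ?_
    change derMul i (monomial θ b) * g = derMul i (monomial θ b * g)
    rw [derMul_monomial, monomial_mul, derMul_smul, mul_def, map_add]
    change monomial θ _ * g + monomial _ _ * g = _
    rw [monomial_mul, monomial_mul, powMul_add, powMul_single]
    rfl
  exact DFunLike.congr_fun h f

theorem powMul_mul (θ : Fin m →₀ ℕ) : ∀ f g : DiffOp m K, powMul θ f * g = powMul θ (f * g) := by
  have hpow : ∀ (i : Fin m) (k : ℕ) (f g : DiffOp m K),
      powMul (Finsupp.single i k) f * g = powMul (Finsupp.single i k) (f * g) := by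
    intro i k
    induction k with
    | zero =>
      intro f g
      rw [Finsupp.single_zero, powMul_zero]
      rfl
    | succ k ih =>
      intro f g
      rw [Finsupp.single_add, powMul_add, powMul_single]
      change powMul _ (derMul i f) * g = powMul _ (derMul i (f * g))
      rw [ih, derMul_mul]
  induction θ using Finsupp.induction_linear with
  | zero =>
    intro f g
    rw [powMul_zero]
    rfl
  | add θ η h1 h2 =>
    intro f g
    rw [powMul_add]
    change powMul θ (powMul η f) * g = powMul θ (powMul η (f * g))
    rw [h1, h2]
  | single i k => exact hpow i k

theorem powMul_one (θ : Fin m →₀ ℕ) : powMul θ (1 : DiffOp m K) = monomial θ 1 := by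
  have key : ∀ θ η : Fin m →₀ ℕ, powMul θ (monomial η (1 : K)) = monomial (θ + η) 1 := by
    intro θ
    induction θ using Finsupp.induction_linear with
    | zero =>
      intro η
      rw [powMul_zero, zero_add]
      rfl
    | add θ₁ θ₂ h1 h2 =>
      intro η
      rw [powMul_add]
      change powMul θ₁ (powMul θ₂ _) = _
      rw [h2, h1, add_assoc]
    | single i k =>
      induction k with
      | zero =>
        intro η
        rw [Finsupp.single_zero, powMul_zero, zero_add]
        rfl
      | succ k ih =>
        intro η
        rw [Finsupp.single_add, powMul_add, powMul_single]
        change powMul _ (derMul i _) = _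
        have h0 : monomial η (0 : K) = 0 := Finsupp.single_zero η
        rw [derMul_monomial, Derivation.map_one_eq_zero, h0, zero_add, ih, add_assoc]
  have h := key θ 0
  rw [add_zero] at h
  exact h

instance : Ring (DiffOp m K) where
  __ := (inferInstance : AddCommGroup (DiffOp m K))
  mul_assoc f g h := by
    let l : DiffOp m K →+ DiffOp m K := (mulHom.flip h).comp (mulHom.flip g)
    let r : DiffOp m K →+ DiffOp m K := mulHom.flip (g * h)
    have e : l = r := by
      refine add_hom_ext fun θ b => ?_
      change monomial θ b * g * h = monomial θ b * (g * h)
      rw [monomial_mul, monomial_mul, smul_mul, powMul_mul]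
    exact DFunLike.congr_fun e f
  one_mul f := by
    change monomial 0 1 * f = f
    rw [monomial_mul, powMul_zero, one_smul]
    rfl
  mul_one f := by
    let l : DiffOp m K →+ DiffOp m K := mulHom.flip 1
    have e : l = AddMonoidHom.id _ := by
      refine add_hom_ext fun θ b => ?_
      change monomial θ b * 1 = monomial θ b
      rw [monomial_mul, powMul_one, smul_monomial, mul_one]
    exact DFunLike.congr_fun e f
  left_distrib f g h := map_add (mulHom f) g h
  right_distrib f g h := by
    change mulHom (f + g) h = _
    rw [map_add]
    rfl
  zero_mul f := by
    change mulHom 0 f = 0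
    rw [map_zero]
    rfl
  mul_zero f := map_zero (mulHom f)

instance : IsScalarTower K (DiffOp m K) (DiffOp m K) := ⟨fun a f g => smul_mul a f g⟩

/-- The commutation rule `∂_i a = a ∂_i + ∂_i(a)` of the ring of differential operators. -/
theorem der_mul_coeff (i : Fin m) (a : K) :
    monomial (Finsupp.single i 1) 1 * monomial 0 a
      = monomial 0 a * monomial (Finsupp.single i 1) 1 + monomial 0 (DeltaRing.der i a) := by
  rw [monomial_mul, monomial_mul, powMul_single, powMul_zero, one_smul, derMul_monomial, add_zero]
  change _ = a • monomial _ 1 + _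
  rw [smul_monomial, mul_one, add_comm]

/-- The rule `(a ∂^θ) ∂^η = a ∂^(θ + η)`; in particular `∂_i ∂_j = ∂_j ∂_i`. -/
theorem monomial_mul_monomial_one (θ η : Fin m →₀ ℕ) (a : K) :
    monomial θ a * monomial η 1 = monomial (θ + η) a := by
  rw [monomial_mul, ← powMul_one η]
  have h : powMul θ (powMul η (1 : DiffOp m K)) = powMul (θ + η) 1 := by
    rw [powMul_add]
    rfl
  rw [h, powMul_one, smul_monomial, mul_one]


end DiffOp

section System

variable {m : ℕ} {K : Type*} [CommRing K]

/-- The order of an operator: the largest `ord ∂^θ = θ_1 + ⋯ + θ_m` with a non-zero coefficient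
(`⊥` for the zero operator). -/
def DiffOp.ord (f : DiffOp m K) : WithBot ℕ :=
  f.support.sup fun θ => (θ.degree : WithBot ℕ)

/-- The term `D_r = {f ∈ D | ord f ≤ r}` of the order filtration of `D`. -/
def DiffOp.filtration (m : ℕ) (K : Type*) [CommRing K] (r : ℕ) : Submodule K (DiffOp m K) where
  carrier := {f | f.ord ≤ r}
  zero_mem' := by
    change (Finset.sup (Finsupp.support (0 : (Fin m →₀ ℕ) →₀ K)) _ : WithBot ℕ) ≤ r
    simp
  add_mem' := by
    intro f g hf hg
    classical
    refine Finset.sup_le (a := (r : WithBot ℕ)) fun θ hθ => ?_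
    rcases Finset.mem_union.1
      (Finsupp.support_add (g₁ := (f : (Fin m →₀ ℕ) →₀ K)) (g₂ := g) hθ) with h | h
    · exact (Finset.le_sup (f := fun θ : Fin m →₀ ℕ => (θ.degree : WithBot ℕ)) h).trans hf
    · exact (Finset.le_sup (f := fun θ : Fin m →₀ ℕ => (θ.degree : WithBot ℕ)) h).trans hg
  smul_mem' := by
    intro a f hf
    refine Finset.sup_le (a := (r : WithBot ℕ)) fun θ hθ => ?_
    have h : θ ∈ f.support := Finsupp.support_smul (b := a) (g := (f : (Fin m →₀ ℕ) →₀ K)) hθ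
    exact (Finset.le_sup (f := fun θ : Fin m →₀ ℕ => (θ.degree : WithBot ℕ)) h).trans hf

/-- The ring `K{y_1, …, y_n}` of differential polynomials, i.e. of polynomials in the derivatives
`∂^θ y_j`; the variable `(j, θ)` is `∂^θ y_j`. -/
abbrev DiffPoly (m n : ℕ) (K : Type*) [CommRing K] : Type _ :=
  MvPolynomial (Fin n × (Fin m →₀ ℕ)) K

variable {n : ℕ}

/-- A linear differential polynomial: one of degree `1` (a constant term is allowed). -/
def DiffPoly.IsLinear (f : DiffPoly m n K) : Prop := f.totalDegree = 1

open Classical in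
/-- `ord_{y_j} f`: the largest order of a derivative of `y_j` occurring in `f` (`⊥` if none does). -/
def DiffPoly.ordIn (j : Fin n) (f : DiffPoly m n K) : WithBot ℕ :=
  (f.vars.filter fun v => v.1 = j).sup fun v => (v.2.degree : WithBot ℕ)

/-- The differential `∑ a_{j,θ} ∂^θ m_j` of a linear differential polynomial
`∑ a_{j,θ} ∂^θ y_j + b`, in the free left `D`-module `M = D^n` with basis `m_j = δ(y_j)`. -/
def DiffPoly.differential (f : DiffPoly m n K) : Fin n → DiffOp m K :=
  ∑ v ∈ f.vars, Pi.single v.1 (DiffOp.monomial v.2 (f.coeff (Finsupp.single v 1)))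

variable [DeltaRing m K]

/-- The `D`-submodule `N ⊆ M` generated by the differentials of the elements of a linear system. -/
def relationModule (S : Set (DiffPoly m n K)) : Submodule (DiffOp m K) (Fin n → DiffOp m K) :=
  Submodule.span (DiffOp m K) (DiffPoly.differential '' S)

/-- The module of differentials `M/N` of a linear system. -/
abbrev DifferentialModule (S : Set (DiffPoly m n K)) : Type _ :=
  (Fin n → DiffOp m K) ⧸ relationModule S

/-- The class in `M/N` of the generator `m_j` of `M`. -/
def DifferentialModule.gen (S : Set (DiffPoly m n K)) (j : Fin n) : DifferentialModule S :=
  (relationModule S).mkQ (Pi.single j 1)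

/-- The term `(M/N)_r` of the filtration of `M/N`: the image of `M_r = D_r m_1 + ⋯ + D_r m_n`. -/
def DifferentialModule.filtration (S : Set (DiffPoly m n K)) (r : ℕ) :
    Submodule K (DifferentialModule S) :=
  (Submodule.pi Set.univ fun _ : Fin n => DiffOp.filtration m K r).map
    ((relationModule S).mkQ.restrictScalars K)

/-- The Hilbert function `r ↦ dim_K (M/N)_r` of a linear system. -/
def hilbertFunction (S : Set (DiffPoly m n K)) (r : ℕ) : ℕ :=
  Module.finrank K (DifferentialModule.filtration S r)

/-- The Kolchin dimension polynomial `ω_{[S]}` of the system (the polynomial of degree at most `m`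
equal to the Hilbert function at all large integers) has the standard coefficients
`a_m, …, a_0`, that is, `ω_{[S]}(s) = ∑ i ≤ m, a_i * binom(s + i, i)`. -/
def HasKolchinCoefficients (S : Set (DiffPoly m n K)) (a : Fin (m + 1) → ℤ) : Prop :=
  ∀ᶠ s : ℕ in Filter.atTop,
    (hilbertFunction S s : ℤ) = ∑ i : Fin (m + 1), a i * ((s + (i : ℕ)).choose (i : ℕ) : ℤ)

/-- The system `S`, viewed over a `K`-algebra `L`.  Its module of differentials, over the ring
`L ⊗_K D` of differential operators over `L`, is `L ⊗_K (M/N)`. -/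
def extendSystem (L : Type*) [CommRing L] [Algebra K L] (S : Set (DiffPoly m n K)) :
    Set (DiffPoly m n L) :=
  MvPolynomial.map (algebraMap K L) '' S

end System

end

/-! Write C(s) = binom(s + m, m), the dimension of the operators of order at most s, and E for the
sum of the e_j. The proof finds one non-zero operator p with p ψ = 0 and differentiates this
relation to recover every generator from ψ, without raising the order.

Take c_1 = 1 and differential indeterminates c_2, …, c_n, and put ψ = ∑ c_k m_k. Let p ψ = 0, where
p has order d and a coefficient p_θ ≠ 0 with |θ| = d. Apply X = ∂/∂(∂^θ c_j) to all coefficients.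
The relations are generated over F, so X preserves them (`coeffDer_mem`). By the Leibniz rule the
composite p ∘ c_j contains ∂^θ c_j explicitly only in the term p_θ ∂^θ c_j of order zero
(`coeffDer_mul_monomial_zero`). Hence X(p) ψ + p_θ m_j = 0, that is, m_j = -p_θ⁻¹ X(p) ψ
(`exists_smul_sub_single_mem`). Finally m_1 = ψ - ∑ c_j m_j.

Such a p of order at most s exists as soon as dim (M/N)_s < C(s), because q ↦ q ψ then cannot be
injective. Since a_m = 0, this inequality holds for arbitrarily large s, so every m_j is torsion.
Over the division ring of fractions of D the differentials of the system therefore span, and n of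
them are independent. These n relations alone give dim (M/N)_s ≤ ∑ C(s + e_j) - n C(s) ≤ C(s + E) -
C(s), the last step by convexity. At s = 2^m E this is less than C(s), since C(s + E) / C(s) ≤ (1 +
2^(-m))^m < 2 when E > 0 (`hilbertFunction_lt`). Extending the field does not increase the Hilbert
function (`hilbertFunction_extendSystem_le`). -/

noncomputable section

namespace DiffOp

/-! ### Coefficients and the order filtration of operators. -/

section Filtration

variable {m : ℕ} {K : Type*} [CommRing K]

theorem coeff_monomial (θ η : Fin m →₀ ℕ) (a : K) :
    coeff (monomial θ a) η = if θ = η then a else 0 := by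
  classical
  exact Finsupp.single_apply

theorem coeff_add (f g : DiffOp m K) (θ : Fin m →₀ ℕ) :
    coeff (f + g) θ = coeff f θ + coeff g θ := rfl

theorem coeff_smul (a : K) (f : DiffOp m K) (θ : Fin m →₀ ℕ) :
    coeff (a • f) θ = a * coeff f θ := rfl

theorem coeff_zero (θ : Fin m →₀ ℕ) : coeff (0 : DiffOp m K) θ = 0 := rfl

theorem ext_coeff {f g : DiffOp m K} (h : ∀ θ, coeff f θ = coeff g θ) : f = g :=
  Finsupp.ext h

theorem monomial_zero (θ : Fin m →₀ ℕ) : monomial θ (0 : K) = 0 := Finsupp.single_zero θ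

theorem one_def : (1 : DiffOp m K) = monomial 0 1 := rfl

theorem mem_support {f : DiffOp m K} {θ : Fin m →₀ ℕ} : θ ∈ f.support ↔ coeff f θ ≠ 0 :=
  Finsupp.mem_support_iff

theorem eq_sum_monomial (f : DiffOp m K) : f = ∑ θ ∈ f.support, monomial θ (coeff f θ) :=
  (Finsupp.sum_single f).symm

theorem mem_filtration {f : DiffOp m K} {r : ℕ} :
    f ∈ filtration m K r ↔ ∀ θ, coeff f θ ≠ 0 → θ.degree ≤ r := by
  change Finset.sup _ _ ≤ (r : WithBot ℕ) ↔ _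
  rw [Finset.sup_le_iff]
  simp only [mem_support, Nat.cast_withBot, WithBot.coe_le_coe]

theorem mem_filtration_iff_ord_le {f : DiffOp m K} {r : ℕ} :
    f ∈ filtration m K r ↔ f.ord ≤ r := Iff.rfl

theorem coeff_eq_zero_of_mem_filtration {f : DiffOp m K} {r : ℕ} (hf : f ∈ filtration m K r)
    {θ : Fin m →₀ ℕ} (h : r < θ.degree) : coeff f θ = 0 := by
  by_contra h'
  exact absurd (mem_filtration.1 hf θ h') (not_le.2 h)

theorem filtration_mono {r s : ℕ} (h : r ≤ s) : filtration m K r ≤ filtration m K s :=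
  fun _ hf => mem_filtration.2 fun θ hθ => (mem_filtration.1 hf θ hθ).trans h

theorem monomial_mem_filtration {θ : Fin m →₀ ℕ} {r : ℕ} (h : θ.degree ≤ r) (a : K) :
    monomial θ a ∈ filtration m K r := by
  refine mem_filtration.2 fun η hη => ?_
  rw [coeff_monomial] at hη
  split_ifs at hη with h'
  · exact h' ▸ h
  · exact absurd rfl hη

theorem filtration_induction {r : ℕ} {p : DiffOp m K → Prop} (zero : p 0)
    (add : ∀ f g, p f → p g → p (f + g))
    (mono : ∀ θ a, θ.degree ≤ r → p (monomial θ a)) {f : DiffOp m K}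
    (hf : f ∈ filtration m K r) : p f := by
  rw [eq_sum_monomial f]
  exact Finset.sum_induction _ p add zero
    fun θ hθ => mono _ _ (mem_filtration.1 hf θ (mem_support.1 hθ))

theorem exists_mem_filtration_degree_eq {f : DiffOp m K} (hf : f ≠ 0) :
    ∃ θ, coeff f θ ≠ 0 ∧ f ∈ filtration m K θ.degree := by
  have hne : f.support.Nonempty := Finsupp.support_nonempty_iff.2 hf
  obtain ⟨θ, hθ, h⟩ := f.support.exists_max_image (fun θ => θ.degree) hne
  exact ⟨θ, mem_support.1 hθ, mem_filtration.2 fun η hη => h η (mem_support.2 hη)⟩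

theorem exists_mem_filtration (f : DiffOp m K) : ∃ r, f ∈ filtration m K r :=
  ⟨f.support.sup fun θ => θ.degree, mem_filtration.2 fun _ hθ =>
    Finset.le_sup (f := fun θ : Fin m →₀ ℕ => θ.degree) (mem_support.2 hθ)⟩

/-- The polynomial in commuting variables with the same coefficients as an operator. -/
def toMvPolynomial : DiffOp m K →ₗ[K] MvPolynomial (Fin m) K :=
  Finsupp.lsum K MvPolynomial.monomial

theorem toMvPolynomial_monomial (θ : Fin m →₀ ℕ) (a : K) :
    toMvPolynomial (monomial θ a) = MvPolynomial.monomial θ a :=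
  Finsupp.lsum_single _ _ _ _

theorem coeff_toMvPolynomial (f : DiffOp m K) (η : Fin m →₀ ℕ) :
    MvPolynomial.coeff η (toMvPolynomial f) = coeff f η := by
  classical
  let l : DiffOp m K →+ K :=
    (MvPolynomial.lcoeff K η).toAddMonoidHom.comp toMvPolynomial.toAddMonoidHom
  let r : DiffOp m K →+ K := Finsupp.applyAddHom η
  have h : l = r := by
    refine add_hom_ext fun θ a => ?_
    change MvPolynomial.coeff η (toMvPolynomial (monomial θ a)) = coeff (monomial θ a) η
    rw [toMvPolynomial_monomial, MvPolynomial.coeff_monomial, coeff_monomial]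
  exact DFunLike.congr_fun h f

end Filtration

/-! ### Leading coefficients of products, and absence of zero divisors. -/

section Mul

variable {m : ℕ} {K : Type*} [CommRing K] [DeltaRing m K]

theorem coeff_derMul (i : Fin m) (f : DiffOp m K) (η : Fin m →₀ ℕ) :
    coeff (derMul i f) η = DeltaRing.der i (coeff f η)
      + MvPolynomial.coeff η (MvPolynomial.X i * toMvPolynomial f) := by
  classical
  let ev : DiffOp m K →+ K := Finsupp.applyAddHom η
  let l : DiffOp m K →+ K := ev.comp (derMul i)
  let r : DiffOp m K →+ K := (DeltaRing.der (K := K) i).toLinearMap.toAddMonoidHom.comp ev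
    + (MvPolynomial.lcoeff K η).toAddMonoidHom.comp
        ((AddMonoidHom.mulLeft (MvPolynomial.X i)).comp toMvPolynomial.toAddMonoidHom)
  have h : l = r := by
    refine add_hom_ext fun θ a => ?_
    change coeff (derMul i (monomial θ a)) η = DeltaRing.der i (coeff (monomial θ a) η)
      + MvPolynomial.coeff η (MvPolynomial.X i * toMvPolynomial (monomial θ a))
    rw [derMul_monomial, coeff_add, coeff_monomial, coeff_monomial, coeff_monomial,
      toMvPolynomial_monomial, MvPolynomial.X, MvPolynomial.monomial_mul, one_mul,
      MvPolynomial.coeff_monomial, apply_ite (DeltaRing.der (K := K) i), map_zero]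
  exact DFunLike.congr_fun h f

theorem derMul_mem_filtration (i : Fin m) {f : DiffOp m K} {r : ℕ} (hf : f ∈ filtration m K r) :
    derMul i f ∈ filtration m K (r + 1) := by
  refine filtration_induction (p := fun f => derMul i f ∈ filtration m K (r + 1)) ?_ ?_ ?_ hf
  · rw [map_zero]
    exact zero_mem _
  · intro f g hf hg
    rw [map_add]
    exact add_mem hf hg
  · intro θ a h
    rw [derMul_monomial]
    refine add_mem (monomial_mem_filtration (by omega) _) (monomial_mem_filtration ?_ _)
    rw [map_add, Finsupp.degree_single]
    omega

@[elab_as_elim]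
theorem exponent_induction {p : (Fin m →₀ ℕ) → Prop} (zero : p 0)
    (add_single : ∀ i θ, p θ → p (Finsupp.single i 1 + θ)) (θ : Fin m →₀ ℕ) : p θ := by
  have key : ∀ d (θ : Fin m →₀ ℕ), θ.degree = d → p θ := by
    intro d
    induction d with
    | zero =>
      intro θ h
      rwa [(Finsupp.degree_eq_zero_iff θ).1 h]
    | succ d ih =>
      intro θ h
      have hne : θ ≠ 0 := by
        rintro rfl
        simp at h
      obtain ⟨i, hi⟩ := Finsupp.ne_iff.1 hne
      have hle : Finsupp.single i 1 ≤ θ := Finsupp.single_le_iff.2 (Nat.one_le_iff_ne_zero.2 hi)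
      have hθ : Finsupp.single i 1 + (θ - Finsupp.single i 1) = θ := add_tsub_cancel_of_le hle
      rw [← hθ]
      refine add_single _ _ (ih _ ?_)
      rw [← hθ, map_add, Finsupp.degree_single] at h
      omega
  exact key _ θ rfl

theorem powMul_single_add (i : Fin m) (θ : Fin m →₀ ℕ) (f : DiffOp m K) :
    powMul (Finsupp.single i 1 + θ) f = derMul i (powMul θ f) := by
  rw [powMul_add, powMul_single]
  rfl

theorem powMul_zero_apply (f : DiffOp m K) : powMul 0 f = f := by
  rw [powMul_zero]
  rfl

theorem powMul_mem_filtration (θ : Fin m →₀ ℕ) {f : DiffOp m K} {r : ℕ}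
    (hf : f ∈ filtration m K r) : powMul θ f ∈ filtration m K (θ.degree + r) := by
  induction θ using exponent_induction with
  | zero => simpa [powMul_zero_apply] using hf
  | add_single i θ ih =>
    rw [powMul_single_add, map_add, Finsupp.degree_single, add_assoc, add_comm 1]
    exact derMul_mem_filtration i ih

/-- Moving a derivation past a coefficient costs one order, so in the top degree the operators
behave like commuting polynomials. -/
theorem coeff_powMul_of_le (θ : Fin m →₀ ℕ) {f : DiffOp m K} {r : ℕ}
    (hf : f ∈ filtration m K r) : ∀ η : Fin m →₀ ℕ, θ.degree + r ≤ η.degree →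
      coeff (powMul θ f) η
        = MvPolynomial.coeff η (MvPolynomial.monomial θ 1 * toMvPolynomial f) := by
  classical
  induction θ using exponent_induction with
  | zero =>
    intro η _
    rw [powMul_zero_apply, ← coeff_toMvPolynomial]
    simp
  | add_single i θ ih =>
    intro η h
    rw [map_add, Finsupp.degree_single] at h
    rw [powMul_single_add, coeff_derMul,
      coeff_eq_zero_of_mem_filtration (powMul_mem_filtration θ hf) (by omega), map_zero, zero_add,
      ← one_mul (1 : K), ← MvPolynomial.monomial_mul, mul_assoc]
    change _ = MvPolynomial.coeff η (MvPolynomial.X i * _)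
    rw [MvPolynomial.coeff_X_mul', MvPolynomial.coeff_X_mul']
    split_ifs with hi
    · rw [coeff_toMvPolynomial]
      refine ih _ ?_
      have hle : Finsupp.single i 1 ≤ η :=
        Finsupp.single_le_iff.2 (Nat.one_le_iff_ne_zero.2 (Finsupp.mem_support_iff.1 hi))
      have h' := congrArg Finsupp.degree (add_tsub_cancel_of_le hle)
      rw [map_add, Finsupp.degree_single] at h'
      omega
    · rfl

theorem mul_mem_filtration {f g : DiffOp m K} {r s : ℕ} (hf : f ∈ filtration m K r)
    (hg : g ∈ filtration m K s) : f * g ∈ filtration m K (r + s) := by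
  refine filtration_induction (p := fun f => f * g ∈ filtration m K (r + s)) ?_ ?_ ?_ hf
  · rw [zero_mul]
    exact zero_mem _
  · intro f g hf hg
    rw [add_mul]
    exact add_mem hf hg
  · intro θ a h
    rw [monomial_mul]
    exact Submodule.smul_mem _ _ (filtration_mono (by omega) (powMul_mem_filtration θ hg))

/-- Multiplicativity of the principal symbol. Restricting to degrees at least r + s makes it
possible to use the whole polynomials: their lower terms do not contribute there. -/
theorem coeff_mul_of_le {f g : DiffOp m K} {r s : ℕ} (hf : f ∈ filtration m K r)
    (hg : g ∈ filtration m K s) {η : Fin m →₀ ℕ} (h : r + s ≤ η.degree) :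
    coeff (f * g) η = MvPolynomial.coeff η (toMvPolynomial f * toMvPolynomial g) := by
  refine filtration_induction (p := fun f => coeff (f * g) η
    = MvPolynomial.coeff η (toMvPolynomial f * toMvPolynomial g)) ?_ ?_ ?_ hf
  · rw [zero_mul, map_zero, zero_mul]
    rfl
  · intro f₁ f₂ h₁ h₂
    rw [add_mul, map_add, add_mul, coeff_add, MvPolynomial.coeff_add, h₁, h₂]
  · intro θ a hθ
    rw [monomial_mul, coeff_smul, coeff_powMul_of_le θ hg η (by omega), toMvPolynomial_monomial]
    have ha : MvPolynomial.monomial θ a = MvPolynomial.C a * MvPolynomial.monomial θ 1 := by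
      rw [MvPolynomial.C_mul_monomial, mul_one]
    rw [ha, mul_assoc, MvPolynomial.coeff_C_mul]

instance [IsDomain K] : NoZeroDivisors (DiffOp m K) where
  eq_zero_or_eq_zero_of_mul_eq_zero := by
    intro f g hfg
    by_contra! hne
    obtain ⟨θ, hθ, hf⟩ := exists_mem_filtration_degree_eq hne.1
    obtain ⟨η, hη, hg⟩ := exists_mem_filtration_degree_eq hne.2
    have hf0 : toMvPolynomial f ≠ 0 := fun h => hθ (by rw [← coeff_toMvPolynomial, h]; rfl)
    have hg0 : toMvPolynomial g ≠ 0 := fun h => hη (by rw [← coeff_toMvPolynomial, h]; rfl)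
    have hdeg := MvPolynomial.totalDegree_mul_of_isDomain hf0 hg0
    have h1 : θ.degree ≤ (toMvPolynomial f).totalDegree := by
      refine MvPolynomial.le_totalDegree (MvPolynomial.mem_support_iff.2 ?_)
      rwa [coeff_toMvPolynomial]
    have h2 : η.degree ≤ (toMvPolynomial g).totalDegree := by
      refine MvPolynomial.le_totalDegree (MvPolynomial.mem_support_iff.2 ?_)
      rwa [coeff_toMvPolynomial]
    -- A monomial of maximal degree in the commutative product lies in the range where it agrees
    -- with the operator product.
    obtain ⟨ζ, hζ, hζd⟩ := Finset.exists_mem_eq_sup _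
      (MvPolynomial.support_nonempty.2 (mul_ne_zero hf0 hg0)) fun s => s.sum fun _ e => e
    change MvPolynomial.totalDegree _ = ζ.degree at hζd
    refine MvPolynomial.mem_support_iff.1 hζ ?_
    rw [← coeff_mul_of_le hf hg (by omega), hfg]
    rfl

instance [Nontrivial K] : Nontrivial (DiffOp m K) :=
  ⟨⟨0, 1, fun h => zero_ne_one (α := K) (by
    have := congrArg (fun f => coeff f 0) h
    simp [one_def, coeff_monomial, coeff_zero] at this)⟩⟩

end Mul

end DiffOp

/-! ### Binomial estimates. -/

section Counting

theorem Nat.sum_range_succ_multichoose (m r : ℕ) :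
    ∑ k ∈ Finset.range (r + 1), m.multichoose k = (m + 1).multichoose r := by
  induction r with
  | zero => simp
  | succ r ih => rw [Finset.sum_range_succ, ih, Nat.multichoose_succ_succ, add_comm]

theorem Finsupp.natCard_degree_le (m r : ℕ) :
    Nat.card {θ : Fin m →₀ ℕ // θ.degree ≤ r} = (r + m).choose m := by
  classical
  have h : ∀ θ : Fin m →₀ ℕ, θ ∈ (Finset.range (r + 1)).biUnion
      (fun k => (Finset.univ : Finset (Fin m)).finsuppAntidiag k) ↔ θ.degree ≤ r := by
    intro θ
    simp only [Finset.mem_biUnion, Finset.mem_range, Finset.mem_finsuppAntidiag,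
      Finset.subset_univ, and_true, Order.lt_add_one_iff]
    rw [Finsupp.degree_eq_sum]
    simp
  rw [Nat.subtype_card _ h, Finset.card_biUnion]
  · simp only [Finset.card_finsuppAntidiag_nat_eq_multichoose, Finset.card_univ, Fintype.card_fin]
    rw [Nat.sum_range_succ_multichoose, Nat.multichoose_eq, show m + 1 + r - 1 = r + m by omega,
      Nat.choose_symm_add]
  · intro i _ j _ hij
    refine Finset.disjoint_left.2 fun θ h1 h2 => hij ?_
    rw [Finset.mem_finsuppAntidiag] at h1 h2
    exact h1.1.symm.trans h2.1

/-- The growth of binomial coefficients: `binom(s + c + m, m) / binom(s + m, m)` is at most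
`((s + c) / s) ^ m`. -/
theorem Nat.choose_add_mul_pow_le (s c m : ℕ) :
    (s + c + m).choose m * s ^ m ≤ (s + m).choose m * (s + c) ^ m := by
  induction m with
  | zero => simp
  | succ m ih =>
    have h1 := Nat.add_one_mul_choose_eq (s + c + m) m
    have h2 := Nat.add_one_mul_choose_eq (s + m) m
    refine _root_.le_of_mul_le_mul_left (a := m + 1) ?_ (Nat.succ_pos m)
    calc (m + 1) * ((s + c + m + 1).choose (m + 1) * s ^ (m + 1))
        = ((s + c + m).choose m * s ^ m) * ((s + c + m + 1) * s) := by
          rw [pow_succ]; linear_combination (s ^ m * s) * h1.symm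
      _ ≤ ((s + m).choose m * (s + c) ^ m) * ((s + m + 1) * (s + c)) := by
          refine Nat.mul_le_mul ih ?_
          nlinarith [Nat.zero_le (c * (m + 1))]
      _ = (m + 1) * ((s + m + 1).choose (m + 1) * (s + c) ^ (m + 1)) := by
          rw [pow_succ]; linear_combination ((s + c) ^ m * (s + c)) * h2

/-- A bounded shift does not change the leading growth: the ratio of the two binomials tends to 1.
-/
theorem Nat.exists_mul_choose_lt (m c : ℕ) {k l : ℕ} (h : k < l) :
    ∃ r : ℕ, k * (r + c + m).choose m < l * (r + m).choose m := by
  have ht : Filter.Tendsto (fun r : ℕ => (k : ℝ) * (1 + (c : ℝ) / r) ^ m) Filter.atTop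
      (nhds ((k : ℝ) * (1 + 0) ^ m)) :=
    ((tendsto_const_nhds.add (tendsto_const_div_atTop_nhds_zero_nat _)).pow m).const_mul _
  have hlt : (k : ℝ) * (1 + 0) ^ m < l := by simpa using h
  obtain ⟨r, hr, hr0⟩ := ((ht.eventually (gt_mem_nhds hlt)).and
    (Filter.eventually_gt_atTop 0)).exists
  refine ⟨r, ?_⟩
  have hr0' : (0 : ℝ) < r := by exact_mod_cast hr0
  have h1 : (((r + c + m).choose m : ℕ) : ℝ) * (r : ℝ) ^ m
      ≤ ((r + m).choose m : ℕ) * ((r : ℝ) + c) ^ m := by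
    exact_mod_cast Nat.choose_add_mul_pow_le r c m
  have h2 : (1 + (c : ℝ) / r) ^ m * (r : ℝ) ^ m = ((r : ℝ) + c) ^ m := by
    rw [← mul_pow]
    congr 1
    field_simp
  have hC : (0 : ℝ) < ((r + m).choose m : ℕ) := by
    exact_mod_cast Nat.choose_pos (Nat.le_add_left m r)
  have hp : (0 : ℝ) < (r : ℝ) ^ m := pow_pos hr0' m
  have : (k : ℝ) * ((r + c + m).choose m : ℕ) < l * ((r + m).choose m : ℕ) := by
    refine lt_of_mul_lt_mul_right ?_ hp.le
    calc (k : ℝ) * ((r + c + m).choose m : ℕ) * (r : ℝ) ^ m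
        = k * ((((r + c + m).choose m : ℕ) : ℝ) * (r : ℝ) ^ m) := by ring
      _ ≤ k * (((r + m).choose m : ℕ) * ((r : ℝ) + c) ^ m) := by gcongr
      _ = (k * (1 + (c : ℝ) / r) ^ m) * (((r + m).choose m : ℕ) * (r : ℝ) ^ m) := by
          rw [← h2]; ring
      _ < l * (((r + m).choose m : ℕ) * (r : ℝ) ^ m) := by gcongr
      _ = l * ((r + m).choose m : ℕ) * (r : ℝ) ^ m := by ring
  exact_mod_cast this

/-- Bernoulli's inequality: (1 - 1/(2^m + 1))^m ≥ 1 - m/(2^m + 1) > 1/2, because 2m < 2^m + 1. -/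
theorem two_pow_add_one_pow_lt (m : ℕ) : (2 ^ m + 1) ^ m < 2 * (2 ^ m) ^ m := by
  have hm : 2 * m < 2 ^ m + 1 := by
    induction m with
    | zero => simp
    | succ m ih =>
      rcases Nat.lt_or_ge m 2 with h | h
      · interval_cases m <;> simp
      · have : 2 ^ 2 ≤ 2 ^ m := Nat.pow_le_pow_right (by norm_num) h
        rw [pow_succ]
        omega
  have hx : (0 : ℝ) < (2 : ℝ) ^ m + 1 := by positivity
  have hb := one_add_mul_le_pow (a := -(1 / ((2 : ℝ) ^ m + 1)))
    (by
      have : 1 / ((2 : ℝ) ^ m + 1) ≤ 1 := by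
        rw [div_le_one hx]
        linarith [pow_pos (two_pos : (0 : ℝ) < 2) m]
      linarith) m
  have he : 1 + -(1 / ((2 : ℝ) ^ m + 1)) = 2 ^ m / (2 ^ m + 1) := by
    field_simp
    ring
  rw [he, div_pow, le_div_iff₀ (pow_pos hx m)] at hb
  have hm' : (2 : ℝ) * m < 2 ^ m + 1 := by exact_mod_cast hm
  have h2 : (1 : ℝ) / 2 < 1 + m * -(1 / ((2 : ℝ) ^ m + 1)) := by
    have : (m : ℝ) * (1 / ((2 : ℝ) ^ m + 1)) < 1 / 2 := by
      rw [mul_one_div, div_lt_iff₀ hx]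
      linarith
    linarith
  have h3 := (mul_lt_mul_of_pos_right h2 (pow_pos hx m)).trans_le hb
  have : ((2 : ℝ) ^ m + 1) ^ m < 2 * (2 ^ m) ^ m := by linarith
  exact_mod_cast this

/-- The origin of the factor 2^m in the order bound: enlarging s = 2^m E by E multiplies s by 1 +
2^(-m), whose m-th power is below 2. -/
theorem Nat.choose_two_pow_mul_add_lt (m E : ℕ) :
    (2 ^ m * E + E + m).choose m < 2 * (2 ^ m * E + m).choose m := by
  rcases Nat.eq_zero_or_pos E with rfl | hE
  · simp
  have h := Nat.choose_add_mul_pow_le (2 ^ m * E) E m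
  have hC : 0 < (2 ^ m * E + m).choose m := Nat.choose_pos (Nat.le_add_left m _)
  rw [show 2 ^ m * E + E = (2 ^ m + 1) * E by ring, mul_pow, mul_pow, ← mul_assoc,
    ← mul_assoc] at h
  have h1 := Nat.le_of_mul_le_mul_right h (pow_pos hE m)
  have h2 := (Nat.mul_lt_mul_left hC).2 (two_pow_add_one_pow_lt m)
  refine Nat.lt_of_mul_lt_mul_right (a := (2 ^ m) ^ m) ?_
  rw [show 2 ^ m * E + E = (2 ^ m + 1) * E by ring]
  calc _ ≤ _ := h1
    _ < _ := h2
    _ = _ := by ring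

/-- Convexity of s ↦ binom(s + m, m): by Pascal's rule its increments binom(s + m, m - 1) are
non-decreasing. -/
theorem Nat.choose_add_add_choose_add_le (s m x y : ℕ) :
    (s + x + m).choose m + (s + y + m).choose m
      ≤ (s + (x + y) + m).choose m + (s + m).choose m := by
  induction y with
  | zero => simp
  | succ y ih =>
    rcases m with _ | m
    · simp
    have h1 : (s + (y + 1) + (m + 1)).choose (m + 1)
        = (s + y + (m + 1)).choose m + (s + y + (m + 1)).choose (m + 1) := by
      rw [← Nat.choose_succ_succ' (s + y + (m + 1)) m]
      congr 1
      omega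
    have h2 : (s + (x + (y + 1)) + (m + 1)).choose (m + 1)
        = (s + (x + y) + (m + 1)).choose m + (s + (x + y) + (m + 1)).choose (m + 1) := by
      rw [← Nat.choose_succ_succ' (s + (x + y) + (m + 1)) m]
      congr 1
      omega
    have h3 : (s + y + (m + 1)).choose m ≤ (s + (x + y) + (m + 1)).choose m :=
      Nat.choose_le_choose m (by omega)
    omega

/-- By convexity the extreme case is the one where a single unknown carries the whole sum of the
orders. -/
theorem Nat.sum_choose_add_le (s m : ℕ) {ι : Type*} (t : Finset ι) (e : ι → ℕ) :
    ∑ j ∈ t, (s + e j + m).choose m + (s + m).choose m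
      ≤ (s + ∑ j ∈ t, e j + m).choose m + t.card * (s + m).choose m := by
  classical
  induction t using Finset.induction_on with
  | empty => simp
  | insert j t hj ih =>
    rw [Finset.sum_insert hj, Finset.sum_insert hj, Finset.card_insert_of_notMem hj, add_mul]
    have := Nat.choose_add_add_choose_add_le s m (e j) (∑ j ∈ t, e j)
    omega

end Counting

/-! ### Dimension of the filtration, the Ore condition and the division ring of fractions. -/

namespace DiffOp

variable {m : ℕ} {K : Type*} [Field K]

theorem filtration_eq_supported (r : ℕ) :
    filtration m K r = Finsupp.supported K K {θ : Fin m →₀ ℕ | θ.degree ≤ r} := by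
  ext f
  rw [mem_filtration]
  refine Iff.trans ?_ (Finsupp.mem_supported (M := K) (R := K) f).symm
  exact ⟨fun h θ hθ => h θ (mem_support.1 hθ), fun h θ hθ => h (mem_support.2 hθ)⟩

/-- The coordinates on the operators of order at most `r`. -/
def filtrationEquiv (m : ℕ) (K : Type*) [Field K] (r : ℕ) :
    filtration m K r ≃ₗ[K] ({θ : Fin m →₀ ℕ | θ.degree ≤ r} →₀ K) :=
  let p : Submodule K (DiffOp m K) := Finsupp.supported K K {θ : Fin m →₀ ℕ | θ.degree ≤ r}
  let φ : p ≃ₗ[K] ({θ : Fin m →₀ ℕ | θ.degree ≤ r} →₀ K) := Finsupp.supportedEquivFinsupp _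
  (LinearEquiv.ofEq _ p (filtration_eq_supported r)).trans φ

instance (r : ℕ) : FiniteDimensional K (filtration m K r) := by
  have : Finite {θ : Fin m →₀ ℕ | θ.degree ≤ r} := Finsupp.finite_of_degree_le r
  exact Module.Finite.equiv (filtrationEquiv m K r).symm

theorem finrank_filtration (r : ℕ) :
    Module.finrank K (filtration m K r) = (r + m).choose m := by
  have : Finite {θ : Fin m →₀ ℕ | θ.degree ≤ r} := Finsupp.finite_of_degree_le r
  have : Fintype {θ : Fin m →₀ ℕ | θ.degree ≤ r} := Fintype.ofFinite _
  rw [(filtrationEquiv m K r).finrank_eq, Module.finrank_finsupp_self, ← Nat.card_eq_fintype_card]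
  exact Finsupp.natCard_degree_le m r

variable [DeltaRing m K]

/-- The Ore condition by counting: (b, a) ↦ b f + a g maps two copies of D_r to D_(r+p+q), whose
dimension is less than twice that of D_r for a suitable r. -/
theorem exists_mul_eq_mul (f : DiffOp m K) {g : DiffOp m K} (hg : g ≠ 0) :
    ∃ a b : DiffOp m K, b ≠ 0 ∧ b * f = a * g := by
  obtain ⟨p, hp⟩ := exists_mem_filtration f
  obtain ⟨q, hq⟩ := exists_mem_filtration g
  obtain ⟨r, hr⟩ := Nat.exists_mul_choose_lt m (p + q) one_lt_two
  let φ : filtration m K r × filtration m K r →ₗ[K] filtration m K (r + (p + q)) :=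
    LinearMap.codRestrict _
      ((((LinearMap.toSpanSingleton (DiffOp m K) _ f).restrictScalars K).comp
        (filtration m K r).subtype).coprod
      (((LinearMap.toSpanSingleton (DiffOp m K) _ g).restrictScalars K).comp
        (filtration m K r).subtype))
      (fun x => add_mem
        (filtration_mono (by omega) (mul_mem_filtration x.1.2 hp))
        (filtration_mono (by omega) (mul_mem_filtration x.2.2 hq)))
  have hker : ¬ Function.Injective φ := fun h => by
    have := LinearMap.finrank_le_finrank_of_injective h
    rw [Module.finrank_prod, finrank_filtration, finrank_filtration] at this
    omega
  rw [← LinearMap.ker_eq_bot, Submodule.eq_bot_iff] at hker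
  push Not at hker
  obtain ⟨⟨b, a⟩, hx, hne⟩ := hker
  have hba : (b : DiffOp m K) * f + a * g = 0 := congrArg Subtype.val (LinearMap.mem_ker.1 hx)
  refine ⟨-a, b, fun hb => hne ?_, ?_⟩
  -- If b = 0, then a g = 0 and a = 0 as well, so the kernel element would be trivial.
  · rw [hb, zero_mul, zero_add, mul_eq_zero, or_iff_left hg] at hba
    exact Prod.ext (Subtype.ext hb) (Subtype.ext hba)
  · rw [neg_mul, eq_neg_iff_add_eq_zero, hba]

open nonZeroDivisors in
instance oreSet : OreLocalization.OreSet (DiffOp m K)⁰ :=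
  OreLocalization.oreSetOfNoZeroDivisors
    (fun f g => (exists_mul_eq_mul f (nonZeroDivisors.coe_ne_zero g)).choose)
    (fun f g => ⟨(exists_mul_eq_mul f (nonZeroDivisors.coe_ne_zero g)).choose_spec.choose,
      mem_nonZeroDivisors_of_ne_zero
        (exists_mul_eq_mul f (nonZeroDivisors.coe_ne_zero g)).choose_spec.choose_spec.1⟩)
    (fun f g => (exists_mul_eq_mul f (nonZeroDivisors.coe_ne_zero g)).choose_spec.choose_spec.2)

open nonZeroDivisors in
/-- The division ring of fractions of the ring of differential operators. -/
abbrev Fractions (m : ℕ) (K : Type*) [Field K] [DeltaRing m K] : Type _ :=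
  OreLocalization (DiffOp m K)⁰ (DiffOp m K)

/-- The embedding of the ring of differential operators in its division ring of fractions. -/
def toFractions : DiffOp m K →+* Fractions m K := OreLocalization.numeratorRingHom

theorem toFractions_injective : Function.Injective (toFractions (m := m) (K := K)) :=
  OreLocalization.numeratorHom_inj inf_le_left

/-- If a subset of the free module `D^n` generates a submodule with torsion quotient, then it
contains `n` linearly independent elements. -/
theorem exists_injective_of_torsion {n : ℕ} (s : Set (Fin n → DiffOp m K))
    (h : ∀ j, ∃ p : DiffOp m K, p ≠ 0 ∧ p • Pi.single j 1 ∈ Submodule.span (DiffOp m K) s) :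
    ∃ f : Fin n → Fin n → DiffOp m K, (∀ i, f i ∈ s) ∧
      ∀ a : Fin n → DiffOp m K, ∑ i, a i • f i = 0 → a = 0 := by
  let ι : (Fin n → DiffOp m K) →+ (Fin n → Fractions m K) :=
    AddMonoidHom.compLeft toFractions.toAddMonoidHom (Fin n)
  have hι : ∀ (a : DiffOp m K) x, ι (a • x) = toFractions a • ι x := fun a x => by
    ext j
    exact map_mul toFractions a (x j)
  have hspan : ∀ x ∈ Submodule.span (DiffOp m K) s,
      ι x ∈ Submodule.span (Fractions m K) (ι '' s) := by
    intro x hx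
    induction hx using Submodule.span_induction with
    | mem x hx => exact Submodule.subset_span ⟨x, hx, rfl⟩
    | zero => rw [map_zero]; exact zero_mem _
    | add x y _ _ hx hy => rw [map_add]; exact add_mem hx hy
    | smul a x _ hx => rw [hι]; exact Submodule.smul_mem _ _ hx
  -- The annihilators modulo the span become invertible over the fractions, so every basis vector is
  -- reached.
  have htop : Submodule.span (Fractions m K) (ι '' s) = ⊤ := by
    rw [eq_top_iff, ← (Pi.basisFun (Fractions m K) (Fin n)).span_eq, Submodule.span_le]
    rintro _ ⟨j, rfl⟩
    obtain ⟨p, hp, hpj⟩ := h j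
    have h1 := hspan _ hpj
    rw [hι] at h1
    have hp' : toFractions p ≠ 0 := fun h0 => hp (toFractions_injective (h0.trans (map_zero _).symm))
    have h2 := Submodule.smul_mem _ (toFractions p)⁻¹ h1
    rw [inv_smul_smul₀ hp'] at h2
    have h3 : ι (Pi.single j 1) = Pi.basisFun (Fractions m K) (Fin n) j := by
      rw [Pi.basisFun_apply]
      ext k
      change toFractions (Pi.single (M := fun _ => DiffOp m K) j 1 k) = _
      rcases eq_or_ne k j with rfl | hk
      · rw [Pi.single_eq_same, Pi.single_eq_same, map_one]
      · rw [Pi.single_eq_of_ne hk, Pi.single_eq_of_ne hk, map_zero]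
    rwa [h3] at h2
  -- A basis is selected inside the spanning set itself, which keeps the elements in `s`.
  have hex := Submodule.exists_fun_fin_finrank_span_eq (Fractions m K) (ι '' s)
  rw [htop, finrank_top, Module.finrank_fin_fun] at hex
  obtain ⟨g, hg, -, hli⟩ := hex
  choose f hf hfg using hg
  refine ⟨f, hf, fun a ha => ?_⟩
  have h0 : ∑ i, toFractions (a i) • g i = 0 := by
    have := congrArg ι ha
    rw [map_sum, map_zero] at this
    simpa only [hι, hfg] using this
  have h1 := Fintype.linearIndependent_iff.1 hli _ h0
  ext i
  exact toFractions_injective ((h1 i).trans (map_zero _).symm)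

end DiffOp

/-! ### Torsion and the bound on the Hilbert function. -/

theorem exists_sum_mul_choose_lt {m : ℕ} (a : Fin (m + 1) → ℤ) (ham : a (Fin.last m) = 0) (t : ℕ) :
    ∃ s ≥ t, ∑ i : Fin (m + 1), a i * ((s + (i : ℕ)).choose (i : ℕ) : ℤ)
      < ((s + m).choose m : ℤ) := by
  rcases m with _ | m
  · exact ⟨t, le_rfl, by simp_all⟩
  -- With m + 1 derivations the sum is at most A binom(s + m, m), and binom(s + m + 1, m + 1) is (s
  -- + m + 1)/(m + 1) times that binomial; hence s ≥ A (m + 1) suffices.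
  let A : ℕ := ∑ i : Fin (m + 1), (a i.castSucc).natAbs
  refine ⟨t + A * (m + 1), Nat.le_add_right _ _, ?_⟩
  set s := t + A * (m + 1) with hs
  rw [Fin.sum_univ_castSucc, ham, zero_mul, add_zero]
  have h1 : ∑ i : Fin (m + 1), a i.castSucc * ((s + (i.castSucc : ℕ)).choose (i.castSucc : ℕ) : ℤ)
      ≤ (A * (s + m).choose m : ℕ) := by
    rw [Finset.sum_mul, Nat.cast_sum]
    refine Finset.sum_le_sum fun i _ => ?_
    have hi : (s + (i : ℕ)).choose i ≤ (s + m).choose m := by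
      rw [← Nat.choose_symm_add, ← Nat.choose_symm_add]
      exact Nat.choose_le_choose s (by omega)
    rw [Fin.val_castSucc, Nat.cast_mul, Int.natCast_natAbs]
    exact mul_le_mul (le_abs_self _) (by exact_mod_cast hi) (by positivity) (abs_nonneg _)
  refine h1.trans_lt ?_
  have h2 := Nat.add_one_mul_choose_eq (s + m) m
  have hC : 0 < (s + m).choose m := Nat.choose_pos (Nat.le_add_left m s)
  have h3 : A * (s + m).choose m < (s + m + 1).choose (m + 1) := by
    refine Nat.lt_of_mul_lt_mul_right (a := m + 1) ?_
    rw [← h2]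
    nlinarith
  exact_mod_cast h3

namespace DifferentialModule

open DiffOp

variable {m n : ℕ} {K : Type*} [Field K] [DeltaRing m K]

/-- The `K`-linear map sending a tuple of operators of orders at most `e_j` to its class modulo a
submodule of the free module. -/
def tupleMap (N : Submodule (DiffOp m K) (Fin n → DiffOp m K)) (e : Fin n → ℕ) :
    (∀ j, DiffOp.filtration m K (e j)) →ₗ[K] ((Fin n → DiffOp m K) ⧸ N) :=
  (N.mkQ.restrictScalars K).comp
    (LinearMap.pi fun j => (DiffOp.filtration m K (e j)).subtype.comp (LinearMap.proj j))

theorem mem_range_tupleMap (N : Submodule (DiffOp m K) (Fin n → DiffOp m K)) {e : Fin n → ℕ}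
    {x : Fin n → DiffOp m K} (hx : ∀ j, x j ∈ DiffOp.filtration m K (e j)) :
    N.mkQ x ∈ LinearMap.range (tupleMap N e) :=
  ⟨fun j => ⟨x j, hx j⟩, rfl⟩

theorem filtration_eq_range (S : Set (DiffPoly m n K)) (r : ℕ) :
    filtration S r = LinearMap.range (tupleMap (relationModule S) fun _ => r) := by
  ext x
  constructor
  · rintro ⟨y, hy, rfl⟩
    exact mem_range_tupleMap _ fun j => hy j (Set.mem_univ j)
  · rintro ⟨y, rfl⟩
    exact ⟨fun j => y j, fun j _ => (y j).2, rfl⟩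

instance (S : Set (DiffPoly m n K)) (r : ℕ) : FiniteDimensional K (filtration S r) := by
  rw [filtration_eq_range]
  infer_instance

theorem mkQ_mem_filtration (S : Set (DiffPoly m n K)) {r : ℕ} {x : Fin n → DiffOp m K}
    (hx : ∀ j, x j ∈ DiffOp.filtration m K r) : (relationModule S).mkQ x ∈ filtration S r :=
  ⟨x, fun j _ => hx j, rfl⟩

/-- An operator `p ≠ 0` of order at most `s` with `p u = 0` exists as soon as the dimension of the
`s`-th term of the filtration is smaller than the number of derivatives of order at most `s`. -/
theorem exists_smul_eq_zero (S : Set (DiffPoly m n K)) {s : ℕ}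
    (h : hilbertFunction S s < (s + m).choose m) {u : Fin n → DiffOp m K}
    (hu : ∀ j, u j ∈ DiffOp.filtration m K 0) :
    ∃ p ∈ DiffOp.filtration m K s, p ≠ 0 ∧ p • u ∈ relationModule S := by
  let φ : DiffOp.filtration m K s →ₗ[K] filtration S s :=
    LinearMap.codRestrict _
      ((((relationModule S).mkQ.comp (LinearMap.toSpanSingleton (DiffOp m K) _ u)).restrictScalars
        K).comp (DiffOp.filtration m K s).subtype)
      (fun p => mkQ_mem_filtration S fun j => mul_mem_filtration p.2 (hu j))
  have hker : ¬ Function.Injective φ := fun hφ => by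
    have := LinearMap.finrank_le_finrank_of_injective hφ
    rw [finrank_filtration] at this
    exact absurd h (not_lt.2 this)
  rw [← LinearMap.ker_eq_bot, Submodule.eq_bot_iff] at hker
  push Not at hker
  obtain ⟨p, hp, hne⟩ := hker
  refine ⟨p, p.2, fun h0 => hne (Subtype.ext h0), ?_⟩
  have hq : (relationModule S).mkQ ((p : DiffOp m K) • u) = 0 :=
    congrArg Subtype.val (LinearMap.mem_ker.1 hp)
  exact (Submodule.Quotient.mk_eq_zero _).1 hq

theorem single_mem_filtration_zero (j k : Fin n) :
    (Pi.single j 1 : Fin n → DiffOp m K) k ∈ DiffOp.filtration m K 0 := by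
  rcases eq_or_ne k j with rfl | hk
  · rw [Pi.single_eq_same]
    exact monomial_mem_filtration (by simp) 1
  · rw [Pi.single_eq_of_ne hk]
    exact zero_mem _

/-- A vanishing a_m makes the Hilbert function grow more slowly than dim D_s, so p ↦ p m_j has a
kernel for some s. -/
theorem exists_torsion (S : Set (DiffPoly m n K)) {a : Fin (m + 1) → ℤ}
    (ha : HasKolchinCoefficients S a) (ham : a (Fin.last m) = 0) (j : Fin n) :
    ∃ p : DiffOp m K, p ≠ 0 ∧ p • Pi.single j 1 ∈ relationModule S := by
  obtain ⟨t, ht⟩ := Filter.eventually_atTop.1 ha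
  obtain ⟨s, hs, hlt⟩ := exists_sum_mul_choose_lt a ham t
  rw [← ht s hs] at hlt
  obtain ⟨p, -, hp⟩ := exists_smul_eq_zero S (s := s) (by exact_mod_cast hlt)
    (single_mem_filtration_zero j)
  exact ⟨p, hp⟩

/-- If the relations include `n` independent ones whose `j`-th components have order at most `e_j`,
then the Hilbert function is bounded by that of a square system. -/
theorem hilbertFunction_add_le (S : Set (DiffPoly m n K)) (e : Fin n → ℕ)
    (f : Fin n → Fin n → DiffOp m K) (hf : ∀ i, f i ∈ relationModule S)
    (hfe : ∀ i j, f i j ∈ DiffOp.filtration m K (e j))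
    (hind : ∀ a : Fin n → DiffOp m K, ∑ i, a i • f i = 0 → a = 0) (s : ℕ) :
    hilbertFunction S s + n * (s + m).choose m ≤ ∑ j, (s + e j + m).choose m := by
  -- The combinations ∑ a_i f_i with a_i in D_s form an n C(s)-dimensional subspace of the kernel of
  -- φ; rank-nullity then bounds the range, which contains (M/N)_s.
  let φ := tupleMap (relationModule S) fun j => s + e j
  let χ : (Fin n → DiffOp.filtration m K s) →ₗ[K] (Fin n → DiffOp m K) :=
    ∑ i, ((LinearMap.toSpanSingleton (DiffOp m K) _ (f i)).restrictScalars K).comp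
      ((DiffOp.filtration m K s).subtype.comp (LinearMap.proj i))
  have hχ : ∀ a, χ a = ∑ i, (a i : DiffOp m K) • f i := fun a => by
    simp only [χ, LinearMap.sum_apply]
    rfl
  have hmem : ∀ a j, χ a j ∈ DiffOp.filtration m K (s + e j) := fun a j => by
    rw [hχ, Finset.sum_apply]
    exact sum_mem fun i _ => mul_mem_filtration (a i).2 (hfe i j)
  let χ' : (Fin n → DiffOp.filtration m K s) →ₗ[K] (∀ j, DiffOp.filtration m K (s + e j)) :=
    LinearMap.pi fun j => LinearMap.codRestrict _ ((LinearMap.proj j).comp χ) fun a => hmem a j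
  let χ'' : (Fin n → DiffOp.filtration m K s) →ₗ[K] LinearMap.ker φ :=
    LinearMap.codRestrict _ χ' fun a => by
      rw [LinearMap.mem_ker]
      refine (Submodule.Quotient.mk_eq_zero (relationModule S)).2 ?_
      change χ a ∈ relationModule S
      rw [hχ]
      exact sum_mem fun i _ => Submodule.smul_mem _ _ (hf i)
  have hinj : Function.Injective χ'' := by
    rw [← LinearMap.ker_eq_bot, Submodule.eq_bot_iff]
    intro a ha
    have h0 : χ a = 0 := by
      ext1 j
      exact congrArg (fun x : LinearMap.ker φ => ((x : ∀ j, DiffOp.filtration m K (s + e j)) j :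
        DiffOp m K)) (LinearMap.mem_ker.1 ha)
    rw [hχ] at h0
    ext1 i
    exact Subtype.ext (congrFun (hind _ h0) i)
  have h1 := LinearMap.finrank_le_finrank_of_injective hinj
  have h2 := LinearMap.finrank_range_add_finrank_ker φ
  have h3 : hilbertFunction S s ≤ Module.finrank K (LinearMap.range φ) := by
    refine Submodule.finrank_mono ?_
    rintro _ ⟨x, hx, rfl⟩
    exact mem_range_tupleMap _ fun j =>
      filtration_mono (Nat.le_add_right _ _) (hx j (Set.mem_univ j))
  simp only [Module.finrank_pi_fintype, finrank_filtration, Finset.sum_const, Finset.card_univ,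
    Fintype.card_fin, smul_eq_mul] at h1 h2
  omega

omit [DeltaRing m K] in
theorem differential_mem_filtration {f : DiffPoly m n K} {j : Fin n} {r : ℕ}
    (h : f.ordIn j ≤ r) : f.differential j ∈ DiffOp.filtration m K r := by
  classical
  rw [DiffPoly.differential, Finset.sum_apply]
  refine sum_mem fun v hv => ?_
  rcases eq_or_ne j v.1 with hj | hj
  · subst hj
    rw [Pi.single_eq_same]
    refine monomial_mem_filtration ?_ _
    have := Finset.sup_le_iff.1 h v (by simpa using hv)
    exact_mod_cast this
  · rw [Pi.single_eq_of_ne hj]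
    exact zero_mem _

/-- The independent relations are chosen among the differentials of the system, not merely in N, so
that the bounds e_j apply to them. -/
theorem hilbertFunction_lt (S : Set (DiffPoly m n K)) (e : Fin n → ℕ)
    (hord : ∀ f ∈ S, ∀ j, f.ordIn j ≤ e j)
    {a : Fin (m + 1) → ℤ} (ha : HasKolchinCoefficients S a) (ham : a (Fin.last m) = 0) :
    hilbertFunction S (2 ^ m * ∑ k, e k)
      < (2 ^ m * ∑ k, e k + m).choose m := by
  obtain ⟨f, hf, hind⟩ := exists_injective_of_torsion (DiffPoly.differential '' S)
    (exists_torsion S ha ham)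
  have h1 := hilbertFunction_add_le S e f (fun i => Submodule.subset_span (hf i))
    (fun i j => by
      obtain ⟨g, hg, hgf⟩ := hf i
      rw [← hgf]
      exact differential_mem_filtration (hord g hg j)) hind (2 ^ m * ∑ k, e k)
  have h2 := Nat.sum_choose_add_le (2 ^ m * ∑ k, e k) m Finset.univ e
  have h3 := Nat.choose_two_pow_mul_add_lt m (∑ k, e k)
  rw [Finset.card_univ, Fintype.card_fin] at h2
  omega

end DifferentialModule

/-! ### Adjoining differential indeterminates. -/

section Extension

open nonZeroDivisors

variable {σ F G : Type*} [Field F] [Field G] [Algebra (MvPolynomial σ F) G]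
  [IsFractionRing (MvPolynomial σ F) G] [Algebra F G] [IsScalarTower F (MvPolynomial σ F) G]

theorem Derivation.eq_of_eq_on_generators {D₁ D₂ : Derivation ℤ G G}
    (hC : ∀ a, D₁ (algebraMap F G a) = D₂ (algebraMap F G a))
    (hX : ∀ v, D₁ (algebraMap (MvPolynomial σ F) G (MvPolynomial.X v))
      = D₂ (algebraMap (MvPolynomial σ F) G (MvPolynomial.X v))) : D₁ = D₂ := by
  have hR : ∀ p : MvPolynomial σ F, D₁ (algebraMap _ G p) = D₂ (algebraMap _ G p) := by
    intro p
    induction p using MvPolynomial.induction_on with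
    | C a =>
      have h := hC a
      rwa [IsScalarTower.algebraMap_apply F (MvPolynomial σ F) G] at h
    | add p q hp hq => rw [map_add, map_add, map_add, hp, hq]
    | mul_X p v hp => rw [map_mul, Derivation.leibniz, Derivation.leibniz, hp, hX]
  ext x
  obtain ⟨p, q, hq, rfl⟩ := IsFractionRing.div_surjective (A := MvPolynomial σ F) x
  rw [Derivation.leibniz_div, Derivation.leibniz_div, hR, hR]

/-- A derivation of `F` extends to the field of rational functions, with prescribed values on the
variables. -/
theorem Derivation.exists_extension (d : Derivation ℤ F F)
    (t : σ → G) :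
    ∃ D : Derivation ℤ G G, (∀ a, D (algebraMap F G a) = algebraMap F G (d a)) ∧
      ∀ v, D (algebraMap (MvPolynomial σ F) G (MvPolynomial.X v)) = t v := by
  -- A derivation d is the same as a ring homomorphism a ↦ a + d(a) ε to the dual numbers. This one
  -- extends to polynomials by choosing the images of the variables, and to fractions because a dual
  -- number with non-zero first component is a unit.
  let φ₀ : F →+* TrivSqZeroExt G G :=
    { toFun := fun a => TrivSqZeroExt.inl (algebraMap F G a)
        + TrivSqZeroExt.inr (algebraMap F G (d a))
      map_one' := by ext <;> simp
      map_zero' := by ext <;> simp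
      map_add' := fun a b => by
        rw [map_add, map_add, map_add, TrivSqZeroExt.inl_add, TrivSqZeroExt.inr_add]
        abel
      map_mul' := fun a b => by
        ext
        · simp
        · simp only [Derivation.leibniz, map_add, map_mul, smul_eq_mul, TrivSqZeroExt.snd_add,
            TrivSqZeroExt.snd_inl, TrivSqZeroExt.snd_inr, TrivSqZeroExt.snd_mul,
            TrivSqZeroExt.fst_add, TrivSqZeroExt.fst_inl, TrivSqZeroExt.fst_inr,
            op_smul_eq_smul, smul_eq_mul]
          ring }
  let φ : MvPolynomial σ F →+* TrivSqZeroExt G G := MvPolynomial.eval₂Hom φ₀ fun v =>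
    TrivSqZeroExt.inl (algebraMap (MvPolynomial σ F) G (MvPolynomial.X v))
      + TrivSqZeroExt.inr (t v)
  have hfst : ∀ p, (φ p).fst = algebraMap (MvPolynomial σ F) G p := by
    intro p
    induction p using MvPolynomial.induction_on with
    | C a =>
      rw [← MvPolynomial.algebraMap_eq, ← IsScalarTower.algebraMap_apply]
      simp [φ, φ₀]
    | add p q hp hq => rw [map_add, map_add, TrivSqZeroExt.fst_add, hp, hq]
    | mul_X p v hp =>
      rw [map_mul, map_mul, TrivSqZeroExt.fst_mul, hp]
      simp [φ]
  have hunit : ∀ y : (MvPolynomial σ F)⁰, IsUnit (φ y) := fun y => by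
    rw [TrivSqZeroExt.isUnit_iff_isUnit_fst, hfst]
    exact IsLocalization.map_units G y
  let Φ : G →+* TrivSqZeroExt G G := IsLocalization.lift hunit
  have hΦ : ∀ p, Φ (algebraMap (MvPolynomial σ F) G p) = φ p := fun p =>
    IsLocalization.lift_eq hunit p
  have hΦfst : ∀ x, (Φ x).fst = x := by
    intro x
    have : (TrivSqZeroExt.fstHom G G G).toRingHom.comp Φ = RingHom.id G :=
      IsLocalization.ringHom_ext (MvPolynomial σ F)⁰ (RingHom.ext fun p =>
        (congrArg TrivSqZeroExt.fst (hΦ p)).trans (hfst p))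
    exact DFunLike.congr_fun this x
  let l : G →ₗ[ℤ] G := AddMonoidHom.toIntLinearMap
    { toFun := fun x => (Φ x).snd
      map_zero' := by simp
      map_add' := fun x y => by simp }
  refine ⟨Derivation.mk' l fun x y => ?_, fun a => ?_, fun v => ?_⟩
  · change (Φ (x * y)).snd = x • (Φ y).snd + y • (Φ x).snd
    rw [map_mul, TrivSqZeroExt.snd_mul, hΦfst, hΦfst, op_smul_eq_smul]
  · change (Φ (algebraMap F G a)).snd = _
    rw [IsScalarTower.algebraMap_apply F (MvPolynomial σ F) G, hΦ, MvPolynomial.algebraMap_eq]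
    change (MvPolynomial.eval₂Hom φ₀ _ (MvPolynomial.C a)).snd = _
    rw [MvPolynomial.eval₂Hom_C]
    change (TrivSqZeroExt.inl (algebraMap F G a) + TrivSqZeroExt.inr (algebraMap F G (d a)) :
      TrivSqZeroExt G G).snd = _
    rw [TrivSqZeroExt.snd_add, TrivSqZeroExt.snd_inl, TrivSqZeroExt.snd_inr, zero_add]
  · change (Φ _).snd = _
    rw [hΦ]
    simp [φ]

/-- The variable (j, θ) plays the role of ∂^θ v_j: each ∂_i extends by shifting θ, and the
commutators vanish because they vanish on generators. The partial derivatives X extend the zero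
derivation of F. -/
theorem exists_deltaRing_of_isFractionRing {m n : ℕ} {F G : Type*} [Field F] [DeltaRing m F]
    [Field G] [Algebra (MvPolynomial (Fin n × (Fin m →₀ ℕ)) F) G]
    [IsFractionRing (MvPolynomial (Fin n × (Fin m →₀ ℕ)) F) G] [Algebra F G]
    [IsScalarTower F (MvPolynomial (Fin n × (Fin m →₀ ℕ)) F) G] :
    ∃ (_ : DeltaRing m G) (v : Fin n → (Fin m →₀ ℕ) → G),
      (∀ (i : Fin m) (x : F),
        DeltaRing.der i (algebraMap F G x) = algebraMap F G (DeltaRing.der i x)) ∧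
      (∀ (i : Fin m) j θ, DeltaRing.der i (v j θ) = v j (Finsupp.single i 1 + θ)) ∧
      ∀ j θ, ∃ X : Derivation ℤ G G, (∀ x : F, X (algebraMap F G x) = 0) ∧
        ∀ k η, X (v k η) = if k = j ∧ η = θ then 1 else 0 := by
  classical
  let v : Fin n → (Fin m →₀ ℕ) → G := fun j θ =>
    algebraMap (MvPolynomial (Fin n × (Fin m →₀ ℕ)) F) G (MvPolynomial.X (j, θ))
  have hder := fun i : Fin m => Derivation.exists_extension (G := G)
    (DeltaRing.der (K := F) i) fun w : Fin n × (Fin m →₀ ℕ) => v w.1 (Finsupp.single i 1 + w.2)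
  choose D hDF hDv using hder
  have hv : ∀ i j θ, D i (v j θ) = v j (Finsupp.single i 1 + θ) := fun i j θ => hDv i (j, θ)
  have hcomm : ∀ i j, ⁅D i, D j⁆ = 0 := fun i j => by
    refine Derivation.eq_of_eq_on_generators (σ := Fin n × (Fin m →₀ ℕ)) (F := F)
      (fun a => ?_) fun w => ?_
    · rw [Derivation.commutator_apply, hDF, hDF, hDF, hDF, DeltaRing.der_comm, sub_self]
      rfl
    · change ⁅D i, D j⁆ (v w.1 w.2) = 0
      rw [Derivation.commutator_apply, hv, hv, hv, hv, add_left_comm, sub_self]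
  refine ⟨⟨D, fun i j a => ?_⟩, v, hDF, hv, fun j θ => ?_⟩
  · have := DFunLike.congr_fun (hcomm i j) a
    rw [Derivation.commutator_apply] at this
    exact sub_eq_zero.1 this
  · obtain ⟨X, hXF, hXv⟩ := Derivation.exists_extension (G := G) (0 : Derivation ℤ F F)
      fun w : Fin n × (Fin m →₀ ℕ) => if w.1 = j ∧ w.2 = θ then 1 else 0
    refine ⟨X, fun x => (hXF x).trans (map_zero _), fun k η => (hXv (k, η)).trans ?_⟩
    congr

/-- A differential field has an extension generated by `n` differential indeterminates; `v j θ` is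
the derivative `∂^θ` of the `j`-th one, and `X` is the partial derivative with respect to it. -/
theorem exists_differential_indeterminates (m n : ℕ) (F : Type u) [Field F] [DeltaRing m F] :
    ∃ (G : Type u) (_ : Field G) (_ : DeltaRing m G) (_ : Algebra F G)
      (v : Fin n → (Fin m →₀ ℕ) → G),
      (∀ (i : Fin m) (x : F),
        DeltaRing.der i (algebraMap F G x) = algebraMap F G (DeltaRing.der i x)) ∧
      (∀ (i : Fin m) j θ, DeltaRing.der i (v j θ) = v j (Finsupp.single i 1 + θ)) ∧
      ∀ j θ, ∃ X : Derivation ℤ G G, (∀ x : F, X (algebraMap F G x) = 0) ∧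
        ∀ k η, X (v k η) = if k = j ∧ η = θ then 1 else 0 := by
  obtain ⟨hG, v, h⟩ := exists_deltaRing_of_isFractionRing (m := m) (n := n) (F := F)
    (G := FractionRing (MvPolynomial (Fin n × (Fin m →₀ ℕ)) F))
  exact ⟨_, inferInstance, hG, inferInstance, v, h⟩

end Extension

/-! ### Derivations acting on coefficients, and operators over an extension. -/

namespace DiffOp

section CoeffDer

variable {m : ℕ} {K : Type*} [CommRing K]

/-- A derivation of the coefficients, applied to an operator coefficient by coefficient. -/
def coeffDer (X : Derivation ℤ K K) : DiffOp m K →+ DiffOp m K :=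
  Finsupp.mapRange.addMonoidHom X.toLinearMap.toAddMonoidHom

theorem coeff_coeffDer (X : Derivation ℤ K K) (f : DiffOp m K) (θ : Fin m →₀ ℕ) :
    coeff (coeffDer X f) θ = X (coeff f θ) := rfl

theorem coeffDer_monomial (X : Derivation ℤ K K) (θ : Fin m →₀ ℕ) (a : K) :
    coeffDer X (monomial θ a) = monomial θ (X a) :=
  Finsupp.mapRange_single (hf := map_zero X.toLinearMap.toAddMonoidHom)

theorem coeffDer_smul (X : Derivation ℤ K K) (a : K) (f : DiffOp m K) :
    coeffDer X (a • f) = X a • f + a • coeffDer X f := by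
  refine ext_coeff fun θ => ?_
  rw [coeff_add, coeff_coeffDer, coeff_smul, coeff_smul, coeff_smul, coeff_coeffDer,
    Derivation.leibniz, smul_eq_mul, smul_eq_mul]
  ring

theorem coeffDer_mem_filtration (X : Derivation ℤ K K) {f : DiffOp m K} {r : ℕ}
    (hf : f ∈ filtration m K r) : coeffDer X f ∈ filtration m K r := by
  refine mem_filtration.2 fun θ hθ => mem_filtration.1 hf θ fun h => hθ ?_
  rw [coeff_coeffDer, h, map_zero]

variable [DeltaRing m K]

/-- Leibniz expansion of ∂^θ ∘ v: only the term of order zero carries ∂^θ v, all others have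
derivatives of v of lower order as coefficients. -/
theorem powMul_monomial_zero_sub_mem {v : (Fin m →₀ ℕ) → K}
    (hv : ∀ i θ, DeltaRing.der i (v θ) = v (Finsupp.single i 1 + θ)) (θ : Fin m →₀ ℕ) :
    powMul θ (monomial 0 (v 0)) - monomial 0 (v θ) ∈
      AddSubgroup.closure {x | ∃ ρ η : Fin m →₀ ℕ, η.degree < θ.degree ∧ x = monomial ρ (v η)} := by
  induction θ using exponent_induction with
  | zero =>
    rw [powMul_zero_apply, sub_self]
    exact zero_mem _
  | add_single i θ ih =>
    have hdeg : (Finsupp.single i 1 + θ).degree = θ.degree + 1 := by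
      rw [map_add, Finsupp.degree_single, add_comm]
    have h1 : ∀ x ∈ AddSubgroup.closure
        {x : DiffOp m K | ∃ ρ η : Fin m →₀ ℕ, η.degree < θ.degree ∧ x = monomial ρ (v η)},
        derMul i x ∈ AddSubgroup.closure {x | ∃ ρ η : Fin m →₀ ℕ,
          η.degree < (Finsupp.single i 1 + θ).degree ∧ x = monomial ρ (v η)} := by
      intro x hx
      induction hx using AddSubgroup.closure_induction with
      | mem x hx =>
        obtain ⟨ρ, η, hη, rfl⟩ := hx
        rw [derMul_monomial, hv]
        refine add_mem (AddSubgroup.subset_closure ⟨_, _, ?_, rfl⟩)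
          (AddSubgroup.subset_closure ⟨_, _, ?_, rfl⟩)
        · rw [map_add, map_add, Finsupp.degree_single]
          omega
        · omega
      | zero => rw [map_zero]; exact zero_mem _
      | add x y _ _ hx hy => rw [map_add (derMul i) x y]; exact add_mem hx hy
      | neg x _ hx => rw [map_neg]; exact neg_mem hx
    have h2 := h1 _ ih
    rw [map_sub, derMul_monomial, hv, ← powMul_single_add, sub_add_eq_sub_sub] at h2
    -- The term (∂^θ v) ∂_i produced by the old leading term now counts as a remainder.
    have h3 : monomial (Finsupp.single i 1 + 0) (v θ) ∈ AddSubgroup.closure {x | ∃ ρ η : Fin m →₀ ℕ,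
        η.degree < (Finsupp.single i 1 + θ).degree ∧ x = monomial ρ (v η)} :=
      AddSubgroup.subset_closure ⟨_, θ, by omega, rfl⟩
    have h4 := add_mem h2 h3
    rwa [sub_add_cancel] at h4

/-- Differentiating `f ∘ v` with respect to a derivative `∂^θ v` of the highest order. -/
theorem coeffDer_mul_monomial_zero {X : Derivation ℤ K K} {v : (Fin m →₀ ℕ) → K}
    (hv : ∀ i θ, DeltaRing.der i (v θ) = v (Finsupp.single i 1 + θ)) {θ : Fin m →₀ ℕ} {t : K}
    (hX : ∀ η, X (v η) = if η = θ then t else 0) {f : DiffOp m K}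
    (hf : f ∈ filtration m K θ.degree) :
    coeffDer X (f * monomial 0 (v 0))
      = coeffDer X f * monomial 0 (v 0) + monomial 0 (coeff f θ * t) := by
  -- For |ζ| ≤ |θ| the remainder of the Leibniz expansion has coefficients of order below |θ|, which
  -- X kills.
  have hpow : ∀ ζ : Fin m →₀ ℕ, ζ.degree ≤ θ.degree →
      coeffDer X (powMul ζ (monomial 0 (v 0))) = monomial 0 (X (v ζ)) := by
    intro ζ hζ
    have h1 : ∀ x ∈ AddSubgroup.closure
        {x : DiffOp m K | ∃ ρ η : Fin m →₀ ℕ, η.degree < ζ.degree ∧ x = monomial ρ (v η)},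
        coeffDer X x = 0 := by
      intro x hx
      induction hx using AddSubgroup.closure_induction with
      | mem x hx =>
        obtain ⟨ρ, η, hη, rfl⟩ := hx
        rw [coeffDer_monomial, hX, if_neg, monomial_zero]
        rintro rfl
        omega
      | zero => exact map_zero _
      | add x y _ _ hx hy => rw [map_add, hx, hy, add_zero]
      | neg x _ hx => rw [map_neg, hx, neg_zero]
    have h2 := h1 _ (powMul_monomial_zero_sub_mem hv ζ)
    rw [map_sub, sub_eq_zero, coeffDer_monomial] at h2
    exact h2
  refine filtration_induction (p := fun f => coeffDer X (f * monomial 0 (v 0))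
      = coeffDer X f * monomial 0 (v 0) + monomial 0 (coeff f θ * t)) ?_ ?_ ?_ hf
  · rw [map_zero, zero_mul, map_zero, coeff_zero, zero_mul, monomial_zero, add_zero]
  · intro f g hf hg
    rw [add_mul, map_add, map_add, add_mul, hf, hg, coeff_add, add_mul, monomial_add]
    abel
  · intro ζ b hζ
    rw [monomial_mul, coeffDer_smul, coeffDer_monomial, monomial_mul, hpow ζ hζ, smul_monomial,
      hX, coeff_monomial, ite_mul, mul_ite, mul_zero, zero_mul]

end CoeffDer

section BaseChange

variable {m : ℕ} {K L : Type*} [CommRing K] [CommRing L] [Algebra K L]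

/-- An operator over `K`, viewed over a `K`-algebra `L`. -/
def baseChange (L : Type*) [CommRing L] [Algebra K L] : DiffOp m K →+ DiffOp m L :=
  Finsupp.mapRange.addMonoidHom (algebraMap K L : K →+* L).toAddMonoidHom

theorem baseChange_monomial (θ : Fin m →₀ ℕ) (a : K) :
    baseChange L (monomial θ a) = monomial θ (algebraMap K L a) :=
  Finsupp.mapRange_single (hf := map_zero (algebraMap K L))

theorem baseChange_smul (a : K) (f : DiffOp m K) :
    baseChange L (a • f) = algebraMap K L a • baseChange L f :=
  ext_coeff fun _ => (algebraMap K L).map_mul _ _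

theorem coeffDer_baseChange {X : Derivation ℤ L L} (hX : ∀ x : K, X (algebraMap K L x) = 0)
    (f : DiffOp m K) : coeffDer X (baseChange L f) = 0 :=
  ext_coeff fun θ => hX (coeff f θ)

variable [DeltaRing m K] [DeltaRing m L]

theorem baseChange_powMul (hKL : ∀ (i : Fin m) (x : K),
      DeltaRing.der i (algebraMap K L x) = algebraMap K L (DeltaRing.der i x))
    (θ : Fin m →₀ ℕ) (f : DiffOp m K) :
    baseChange L (powMul θ f) = powMul θ (baseChange L f) := by
  induction θ using exponent_induction with
  | zero => rw [powMul_zero_apply, powMul_zero_apply]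
  | add_single i θ ih =>
    rw [powMul_single_add, powMul_single_add, ← ih]
    have h : (baseChange L).comp (derMul i : DiffOp m K →+ DiffOp m K)
        = (derMul i : DiffOp m L →+ DiffOp m L).comp (baseChange L) := by
      refine add_hom_ext fun θ a => ?_
      change baseChange L (derMul i (monomial θ a)) = derMul i (baseChange L (monomial θ a))
      rw [derMul_monomial, map_add, baseChange_monomial, baseChange_monomial, baseChange_monomial,
        derMul_monomial, hKL]
    exact DFunLike.congr_fun h (powMul θ f)

theorem baseChange_mul (hKL : ∀ (i : Fin m) (x : K),
      DeltaRing.der i (algebraMap K L x) = algebraMap K L (DeltaRing.der i x))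
    (f g : DiffOp m K) : baseChange L (f * g) = baseChange L f * baseChange L g := by
  have h : (baseChange L).comp (AddMonoidHom.mulRight g)
      = (AddMonoidHom.mulRight (baseChange L g)).comp (baseChange L) := by
    refine add_hom_ext fun θ a => ?_
    change baseChange L (monomial θ a * g) = baseChange L (monomial θ a) * baseChange L g
    rw [monomial_mul, baseChange_smul, baseChange_powMul hKL, baseChange_monomial, monomial_mul]
  exact DFunLike.congr_fun h f

/-- Although X need not commute with the ∂_i, all derivatives of coefficients from K stay in K,
where X vanishes. -/
theorem coeffDer_mul_baseChange (hKL : ∀ (i : Fin m) (x : K),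
      DeltaRing.der i (algebraMap K L x) = algebraMap K L (DeltaRing.der i x))
    {X : Derivation ℤ L L} (hX : ∀ x : K, X (algebraMap K L x) = 0)
    (f : DiffOp m L) (g : DiffOp m K) :
    coeffDer X (f * baseChange L g) = coeffDer X f * baseChange L g := by
  have h : (coeffDer X).comp (AddMonoidHom.mulRight (baseChange L g))
      = (AddMonoidHom.mulRight (baseChange L g)).comp (coeffDer X) := by
    refine add_hom_ext fun θ a => ?_
    change coeffDer X (monomial θ a * baseChange L g)
      = coeffDer X (monomial θ a) * baseChange L g
    rw [monomial_mul, coeffDer_smul, ← baseChange_powMul hKL, coeffDer_baseChange hX, smul_zero,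
      add_zero, coeffDer_monomial, monomial_mul, baseChange_powMul hKL]
  exact DFunLike.congr_fun h f

end BaseChange

end DiffOp

/-! ### The module of differentials over an extension field. -/

namespace DifferentialModule

open DiffOp

variable {m n : ℕ} {K L : Type*} [Field K] [Field L] [Algebra K L]

/-- A tuple of operators over `K`, viewed over `L`. -/
def baseChangeTuple (L : Type*) [Field L] [Algebra K L] :
    (Fin n → DiffOp m K) →+ (Fin n → DiffOp m L) :=
  AddMonoidHom.compLeft (baseChange L) (Fin n)

theorem baseChangeTuple_single (j : Fin n) (f : DiffOp m K) :
    baseChangeTuple L (Pi.single j f) = Pi.single j (baseChange L f) :=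
  funext fun k => Pi.apply_single (fun _ => baseChange L) (fun _ => map_zero _) j f k

theorem differential_map (f : DiffPoly m n K) :
    DiffPoly.differential (MvPolynomial.map (algebraMap K L) f)
      = baseChangeTuple L f.differential := by
  classical
  rw [DiffPoly.differential, DiffPoly.differential,
    MvPolynomial.vars_map_of_injective _ (algebraMap K L).injective, map_sum]
  refine Finset.sum_congr rfl fun v _ => ?_
  rw [MvPolynomial.coeff_map, ← baseChange_monomial, baseChangeTuple_single]

variable [DeltaRing m K] [DeltaRing m L]

theorem baseChangeTuple_mem (hKL : ∀ (i : Fin m) (x : K),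
      DeltaRing.der i (algebraMap K L x) = algebraMap K L (DeltaRing.der i x))
    (S : Set (DiffPoly m n K)) {x : Fin n → DiffOp m K} (hx : x ∈ relationModule S) :
    baseChangeTuple L x ∈ relationModule (extendSystem L S) := by
  induction hx using Submodule.span_induction with
  | mem x hx =>
    obtain ⟨f, hf, rfl⟩ := hx
    rw [← differential_map]
    exact Submodule.subset_span ⟨_, ⟨f, hf, rfl⟩, rfl⟩
  | zero => rw [map_zero]; exact zero_mem _
  | add x y _ _ hx hy => rw [map_add]; exact add_mem hx hy
  | smul a x _ hx =>
    have h : baseChangeTuple L (a • x) = baseChange L a • baseChangeTuple L x :=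
      funext fun j => baseChange_mul hKL a (x j)
    rw [h]
    exact Submodule.smul_mem _ _ hx

/-- The generators have coefficients in K, so X acts only on their multipliers. -/
theorem coeffDer_mem (hKL : ∀ (i : Fin m) (x : K),
      DeltaRing.der i (algebraMap K L x) = algebraMap K L (DeltaRing.der i x))
    {X : Derivation ℤ L L} (hX : ∀ x : K, X (algebraMap K L x) = 0)
    (S : Set (DiffPoly m n K)) {x : Fin n → DiffOp m L}
    (hx : x ∈ relationModule (extendSystem L S)) :
    (fun j => coeffDer X (x j)) ∈ relationModule (extendSystem L S) := by
  let Y : (Fin n → DiffOp m L) →+ (Fin n → DiffOp m L) :=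
    AddMonoidHom.compLeft (coeffDer X) (Fin n)
  change Y x ∈ _
  -- The induction uses multiples of generators only: for a general x there is no product rule for
  -- X(a x).
  induction hx using Submodule.closure_induction with
  | zero => rw [map_zero]; exact zero_mem _
  | add x y _ _ hx hy => rw [map_add]; exact add_mem hx hy
  | smul_mem a x hx =>
    obtain ⟨_, ⟨f, hf, rfl⟩, rfl⟩ := hx
    have h : Y (a • DiffPoly.differential (MvPolynomial.map (algebraMap K L) f))
        = coeffDer X a • DiffPoly.differential (MvPolynomial.map (algebraMap K L) f) := by
      rw [differential_map]
      exact funext fun j => coeffDer_mul_baseChange hKL hX a _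
    rw [h]
    exact Submodule.smul_mem _ _ (Submodule.subset_span ⟨_, ⟨f, hf, rfl⟩, rfl⟩)

/-- A K-basis of (M/N)_r spans the corresponding term over L, since relations over K remain
relations over L. -/
theorem hilbertFunction_extendSystem_le (hKL : ∀ (i : Fin m) (x : K),
      DeltaRing.der i (algebraMap K L x) = algebraMap K L (DeltaRing.der i x))
    (S : Set (DiffPoly m n K)) (r : ℕ) :
    hilbertFunction (extendSystem L S) r ≤ hilbertFunction S r := by
  let b := Module.finBasis K (filtration S r)
  have hb : ∀ i, ∃ x : Fin n → DiffOp m K, (relationModule S).mkQ x = b i := fun i =>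
    Submodule.mkQ_surjective _ _
  choose x hx using hb
  let N := relationModule (extendSystem L S)
  let q : (Fin n → DiffOp m L) →ₗ[L] DifferentialModule (extendSystem L S) :=
    N.mkQ.restrictScalars L
  let P : Submodule L (DifferentialModule (extendSystem L S)) :=
    Submodule.span L (Set.range fun i => q (baseChangeTuple L (x i)))
  have hA : ∀ y : Fin n → DiffOp m K, (∀ j, y j ∈ DiffOp.filtration m K r) →
      q (baseChangeTuple L y) ∈ P := by
    intro y hy
    let y' : filtration S r := ⟨_, mkQ_mem_filtration S hy⟩
    have h1 : (relationModule S).mkQ (y - ∑ i, b.repr y' i • x i) = 0 := by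
      have h2 : (relationModule S).mkQ (∑ i, b.repr y' i • x i) = (relationModule S).mkQ y := by
        have h3 := congrArg Subtype.val (b.sum_repr y')
        rw [Submodule.coe_sum] at h3
        rw [map_sum]
        refine Eq.trans (Finset.sum_congr rfl fun i _ => ?_) h3
        rw [Submodule.coe_smul, ← hx]
        rfl
      rw [map_sub, h2, sub_self]
    have h4 := baseChangeTuple_mem (L := L) hKL S ((Submodule.Quotient.mk_eq_zero _).1 h1)
    have h5 : baseChangeTuple L (∑ i, b.repr y' i • x i)
        = ∑ i, algebraMap K L (b.repr y' i) • baseChangeTuple L (x i) := by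
      rw [map_sum]
      exact Finset.sum_congr rfl fun i _ => funext fun j => baseChange_smul _ _
    rw [map_sub, h5] at h4
    have h6 : q (baseChangeTuple L y)
        = q (∑ i, algebraMap K L (b.repr y' i) • baseChangeTuple L (x i)) :=
      (Submodule.Quotient.eq N).2 h4
    rw [h6, map_sum]
    refine sum_mem fun i _ => ?_
    rw [map_smul]
    exact Submodule.smul_mem _ _ (Submodule.subset_span ⟨i, rfl⟩)
  -- Over L the filtration is spanned by the classes of the ∂^θ m_j, which are defined over K.
  have hle : filtration (extendSystem L S) r ≤ P := by
    rintro _ ⟨y, hy, rfl⟩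
    change q y ∈ P
    rw [← Finset.univ_sum_single y, map_sum]
    refine sum_mem fun j _ => ?_
    refine filtration_induction (p := fun f => q (Pi.single j f) ∈ P) ?_ ?_ ?_
      (hy j (Set.mem_univ j))
    · rw [Pi.single_zero, map_zero]
      exact zero_mem _
    · intro f g hf hg
      rw [Pi.single_add, map_add]
      exact add_mem hf hg
    · intro θ a hθ
      have h1 : (Pi.single j (monomial θ a) : Fin n → DiffOp m L)
          = a • baseChangeTuple L (Pi.single j (monomial θ (1 : K))) := by
        rw [baseChangeTuple_single, baseChange_monomial, map_one, ← Pi.single_smul, smul_monomial,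
          mul_one]
      rw [h1, map_smul]
      refine Submodule.smul_mem _ _ (hA _ fun k => ?_)
      rcases eq_or_ne k j with rfl | hk
      · rw [Pi.single_eq_same]
        exact monomial_mem_filtration hθ 1
      · rw [Pi.single_eq_of_ne hk]
        exact zero_mem _
  have hfin : FiniteDimensional L P := FiniteDimensional.span_of_finite L (Set.finite_range _)
  refine (Submodule.finrank_mono hle).trans ((finrank_range_le_card _).trans ?_)
  rw [Fintype.card_fin]
  rfl

end DifferentialModule

/-! ### Recovering the generators from ψ. -/

namespace DifferentialModule

open DiffOp

variable {m n : ℕ} {K L : Type*} [Field K] [Field L] [Algebra K L] [DeltaRing m K] [DeltaRing m L]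

/-- If a non-zero operator of order at most `s` annihilates the class of `∑ w_k m_k`, where `w_j` is
differentially transcendental over the other `w_k`, then `m_j` is obtained from this class by an
operator of order at most `s`. -/
theorem exists_smul_sub_single_mem (hKL : ∀ (i : Fin m) (x : K),
      DeltaRing.der i (algebraMap K L x) = algebraMap K L (DeltaRing.der i x))
    (S : Set (DiffPoly m n K)) {w : Fin n → (Fin m →₀ ℕ) → L}
    (hw : ∀ (i : Fin m) k θ, DeltaRing.der i (w k θ) = w k (Finsupp.single i 1 + θ)) (j : Fin n)
    (hX : ∀ θ, ∃ X : Derivation ℤ L L, (∀ x : K, X (algebraMap K L x) = 0) ∧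
      ∀ k η, X (w k η) = if k = j ∧ η = θ then 1 else 0)
    {s : ℕ} {p : DiffOp m L} (hp : p ∈ DiffOp.filtration m L s) (hp0 : p ≠ 0)
    (hpw : (p • fun k => monomial 0 (w k 0)) ∈ relationModule (extendSystem L S)) :
    ∃ q ∈ DiffOp.filtration m L s,
      (q • (fun k => monomial 0 (w k 0)) - Pi.single j 1 : Fin n → DiffOp m L)
        ∈ relationModule (extendSystem L S) := by
  -- A leading exponent θ of p decides which derivative of w_j to differentiate by.
  obtain ⟨θ, hθ, hpθ⟩ := exists_mem_filtration_degree_eq hp0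
  obtain ⟨X, hXK, hXw⟩ := hX θ
  have h1 := coeffDer_mem hKL hXK S hpw
  have h2 : (fun k => coeffDer X ((p • fun k => monomial 0 (w k 0) : Fin n → DiffOp m L) k))
      = coeffDer X p • (fun k => monomial 0 (w k 0)) + Pi.single j (monomial 0 (coeff p θ)) := by
    ext1 k
    have h3 := coeffDer_mul_monomial_zero (X := X) (v := w k) (θ := θ) (t := if k = j then 1 else 0)
      (fun i θ => hw i k θ) (fun η => by rw [hXw, ite_and]; split_ifs <;> rfl) hpθ
    refine h3.trans (congrArg _ ?_)
    rcases eq_or_ne k j with rfl | hk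
    · rw [Pi.single_eq_same, if_pos rfl, mul_one]
    · rw [Pi.single_eq_of_ne hk, if_neg hk, mul_zero, monomial_zero]
  rw [h2] at h1
  -- This solves X(p) ψ + p_θ m_j = 0 for m_j; X does not raise the order of p.
  refine ⟨-(coeff p θ)⁻¹ • coeffDer X p,
    Submodule.smul_mem _ _ (coeffDer_mem_filtration X hp), ?_⟩
  have h4 := Submodule.smul_mem _ (monomial 0 (-(coeff p θ)⁻¹) : DiffOp m L) h1
  convert h4 using 1
  ext1 k
  change (-(coeff p θ)⁻¹ • coeffDer X p) * monomial 0 (w k 0) - Pi.single (M := fun _ => DiffOp m L)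
    j 1 k = monomial 0 (-(coeff p θ)⁻¹) * (coeffDer X p * monomial 0 (w k 0)
      + Pi.single (M := fun _ => DiffOp m L) j (monomial 0 (coeff p θ)) k)
  rw [monomial_mul, powMul_zero_apply, DiffOp.smul_mul, smul_add, sub_eq_add_neg]
  congr 1
  rcases eq_or_ne k j with rfl | hk
  · rw [Pi.single_eq_same, Pi.single_eq_same, smul_monomial, neg_mul, inv_mul_cancel₀ hθ, one_def]
    exact (Finsupp.single_neg _ _).symm
  · rw [Pi.single_eq_of_ne hk, Pi.single_eq_of_ne hk, neg_zero, smul_zero]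

end DifferentialModule

open DiffOp DifferentialModule in
theorem mainTheorem2 {F : Type u} [Field F] [CharZero F] (m n : ℕ) [NeZero n] [DeltaRing m F]
    (S : Set (DiffPoly m n F)) (hlin : ∀ f ∈ S, f.IsLinear)
    (e : Fin n → ℕ) (hord : ∀ f ∈ S, ∀ j, f.ordIn j ≤ e j)
    (a : Fin (m + 1) → ℤ) (ha : HasKolchinCoefficients S a) (ham : a (Fin.last m) = 0) :
    ∃ (G : Type u) (_ : Field G) (_ : DeltaRing m G) (_ : Algebra F G),
      (∀ (i : Fin m) (x : F),
        DeltaRing.der i (algebraMap F G x) = algebraMap F G (DeltaRing.der i x)) ∧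
      ∃ (c : Fin n → G) (ψ : DifferentialModule (extendSystem G S)),
        ψ = DifferentialModule.gen (extendSystem G S) 0
            + ∑ j ∈ Finset.univ.erase 0,
                c j • DifferentialModule.gen (extendSystem G S) j ∧
        Submodule.span (DiffOp m G) {ψ} = ⊤ ∧
        ∃ l : Fin n → DiffOp m G, ∀ j,
          l j • ψ = DifferentialModule.gen (extendSystem G S) j ∧
          (l j).ord ≤ ((2 ^ m * ∑ k, e k : ℕ) : WithBot ℕ) := by
  obtain ⟨G, _, _, _, v, hFG, hv, hX⟩ := exists_differential_indeterminates m n F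
  refine ⟨G, inferInstance, inferInstance, inferInstance, hFG, ?_⟩
  -- The coefficient of the first generator is the constant 1, with all its proper derivatives 0;
  -- the others are indeterminates.
  let w : Fin n → (Fin m →₀ ℕ) → G := fun k θ =>
    if k = 0 then (if θ = 0 then 1 else 0) else v k θ
  have hw : ∀ (i : Fin m) k θ, DeltaRing.der i (w k θ) = w k (Finsupp.single i 1 + θ) := by
    intro i k θ
    by_cases hk : k = 0
    · have hne : Finsupp.single i 1 + θ ≠ 0 := fun h => by
        have := DFunLike.congr_fun h i
        simp at this
      simp only [w, if_pos hk, if_neg hne]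
      split_ifs
      · exact Derivation.map_one_eq_zero _
      · exact map_zero _
    · simp only [w, if_neg hk, hv]
  set N := relationModule (extendSystem G S)
  let u : Fin n → DiffOp m G := fun k => monomial 0 (w k 0)
  have hu : u = Pi.single 0 1
      + ∑ j ∈ Finset.univ.erase 0, w j 0 • (Pi.single j 1 : Fin n → DiffOp m G) := by
    have h0 : (Pi.single 0 1 : Fin n → DiffOp m G) = w 0 0 • Pi.single 0 1 := by
      simp only [w, if_true, one_smul]
    rw [h0, Finset.add_sum_erase _ (fun j => w j 0 • (Pi.single j 1 : Fin n → DiffOp m G))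
      (Finset.mem_univ 0)]
    ext1 k
    rw [Finset.sum_apply, Finset.sum_eq_single k]
    · rw [Pi.smul_apply, Pi.single_eq_same, one_def, smul_monomial, mul_one]
    · intro j _ hj
      rw [Pi.smul_apply, Pi.single_eq_of_ne hj.symm, smul_zero]
    · exact fun h => absurd (Finset.mem_univ k) h
  have hψ : N.mkQ u = gen (extendSystem G S) 0
      + ∑ j ∈ Finset.univ.erase 0, w j 0 • gen (extendSystem G S) j := by
    change (N.mkQ.restrictScalars G) u = _
    rw [hu, map_add, map_sum]
    rfl
  obtain ⟨p, hp, hp0, hpu⟩ := exists_smul_eq_zero (extendSystem G S)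
    (lt_of_le_of_lt (hilbertFunction_extendSystem_le hFG S _) (hilbertFunction_lt S e hord ha ham))
    (u := u) (fun j => monomial_mem_filtration (by simp) _)
  have hne : ∀ j : Fin n, j ≠ 0 → ∃ q ∈ DiffOp.filtration m G (2 ^ m * ∑ k, e k),
      q • N.mkQ u = gen (extendSystem G S) j := by
    intro j hj
    obtain ⟨q, hq, hqu⟩ := exists_smul_sub_single_mem hFG S hw j (fun θ => by
      obtain ⟨X, hXF, hXv⟩ := hX j θ
      refine ⟨X, hXF, fun k η => ?_⟩
      by_cases hk : k = 0
      · have hwk : w k η = if η = 0 then 1 else 0 := if_pos hk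
        have hkj : ¬(k = j ∧ η = θ) := fun h => hj (h.1.symm.trans hk)
        rw [hwk, if_neg hkj]
        split_ifs
        · exact Derivation.map_one_eq_zero _
        · exact map_zero _
      · simp only [w, if_neg hk, hXv]) hp hp0 hpu
    exact ⟨q, hq, (Submodule.Quotient.eq N).2 hqu⟩
  choose! l hl hlu using hne
  -- The index 0 has no indeterminate to differentiate by, so its operator comes from m_0 = ψ - ∑
  -- c_k m_k.
  let l' : Fin n → DiffOp m G := fun j =>
    if j = 0 then 1 - ∑ k ∈ Finset.univ.erase 0, w k 0 • l k else l j
  have hl' : ∀ j, l' j • N.mkQ u = gen (extendSystem G S) j := by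
    intro j
    by_cases hj : j = 0
    · subst hj
      simp only [l', if_true]
      rw [sub_smul, one_smul, Finset.sum_smul, sub_eq_iff_eq_add]
      refine hψ.trans (congrArg _ (Finset.sum_congr rfl fun k hk => ?_))
      rw [← hlu k (Finset.ne_of_mem_erase hk), smul_assoc]
    · simp only [l', if_neg hj, hlu j hj]
  refine ⟨fun j => w j 0, N.mkQ u, hψ, ?_, l', fun j => ⟨hl' j, ?_⟩⟩
  · rw [eq_top_iff]
    rintro x -
    obtain ⟨y, rfl⟩ := Submodule.mkQ_surjective _ x
    have hy : y = ∑ j, y j • (Pi.single j 1 : Fin n → DiffOp m G) := by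
      conv_lhs => rw [← Finset.univ_sum_single y]
      refine Finset.sum_congr rfl fun j _ => ?_
      rw [← Pi.single_smul, smul_eq_mul, mul_one]
    rw [hy, map_sum]
    refine sum_mem fun j _ => ?_
    rw [map_smul]
    refine Submodule.smul_mem _ _ ?_
    change gen (extendSystem G S) j ∈ _
    rw [← hl' j]
    exact Submodule.smul_mem _ _ (Submodule.mem_span_singleton_self _)
  · refine mem_filtration_iff_ord_le.1 ?_
    by_cases hj : j = 0
    · simp only [l', if_pos hj]
      refine sub_mem (monomial_mem_filtration (by simp) 1) (sum_mem fun k hk => ?_)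
      exact Submodule.smul_mem _ _ (hl k (Finset.ne_of_mem_erase hk))
    · simp only [l', if_neg hj]
      exact hl j hj

end
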